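/- Consider tabular episodic zero-sum Markov games with $H\ge 1$ steps, finite state sets $\mathcal S_h$ ($h\in[H+1]$, $|\mathcal S_h|\le S$), finite non-empty action sets $\mathcal A_h$ of the max-player and $\mathcal B_h$ of the min-player ($h\in[H]$, $|\mathcal A_h|\le A$, $|\mathcal B_h|\le B$), unknown transition distributions $\mathbb P_h(\cdot\mid s,a,b)$ on $\mathcal S_{h+1}$ and unknown deterministic rewards $r_h(s,a,b)\in[0,1]$. For Markov policies $\mu,\nu$ of the two players let $V^{\mu,\nu}(s_1)$ be the expected total reward from $s_1$, and put $V^{\dagger,\nu}(s_1)=\sup_\mu V^{\mu,\nu}(s_1)$, $V^{\mu,\dagger}(s_1)=\inf_\nu V^{\mu,\nu}(s_1)$. The algorithm VI-ULCB plays $K$ episodes, each starting from the same fixed state $s_1$. In episode $k$ it computes, for $h=H,\dots,1$ and from $V^{\rm up}_{H+1}=V^{\rm low}_{H+1}=0$, $$Q^{\rm up}_h=\min\{\hat r_h+\hat{\mathbb P}_hV^{\rm up}_{h+1}+\beta_t,\,H\},\qquad Q^{\rm low}_h=\max\{\hat r_h+\hat{\mathbb P}_hV^{\rm low}_{h+1}-\beta_t,\,0\}$$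 at every $(s,a,b)$ that was visited $t\ge1$ times at step $h$ in the previous episodes, where $\hat{\mathbb P}_h$ is the empirical transition matrix and $\hat r_h$ the observed reward, and $Q^{\rm up}_h=H$, $Q^{\rm low}_h=0$ at unvisited $(s,a,b)$. For every $s$ a subroutine, given the two matrices $Q^{\rm up}_h(s,\cdot,\cdot)$ (payoff of the maximizing row player) and $Q^{\rm low}_h(s,\cdot,\cdot)$ (payoff of the minimizing column player), returns a Nash equilibrium $(\mu^k_h(\cdot|s),\nu^k_h(\cdot|s))$ of this general-sum game, and $V^{\rm up}_h(s)$, $V^{\rm low}_h(s)$ are the expectations of $Q^{\rm up}_h(s,\cdot,\cdot)$, $Q^{\rm low}_h(s,\cdot,\cdot)$ under it. The episode is then played with $(\mu^k,\nu^k)$. The bonus is $\beta_t=c\sqrt{H^2S\,\log(SABT/p)/t}$ with $T=KH$. Then there is an absolute constant $c_0>0$ such that for every $c\ge c_0$ there is a constant $C>0$, depending only on $c$, with the following property. For all such games, all $s_1$, all subroutines that always return a Nash equilibrium, all $p\in(0,1)$, $\epsilon>0$ and all integers $K\ge1$ with $$K\ \ge\ C\,\frac{H^4S^2AB\,\iota}{\epsilon^2},\qquad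 \iota=\log\frac{HSAB}{p\,\min\{\epsilon,1\}},$$ it holds with probability at least $1-p$ over the trajectories of the $K$ episodes that $$\mathbb E_{\hat\mu,\hat\nu}\big[V^{\dagger,\hat\nu}(s_1)-V^{\hat\mu,\dagger}(s_1)\big]\le\epsilon,$$ where $\hat\mu$ is uniform on the list $\mu^1,\dots,\mu^K$ and $\hat\nu$ is uniform on the list $\nu^1,\dots,\nu^K$ of the deployed policies (with any joint law), and the expectation is over this sampling only. -/

import Mathlib

universe u v w

open scoped ENNReal

/-- A tabular episodic zero-sum Markov game with `H` steps. Step `h : Fin H` leads from a state in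
`State h.castSucc` to a state in `State h.succ`; both players act simultaneously at every step.
States, actions of the max-player (`ActMax`) and actions of the min-player (`ActMin`) may depend
on the step. Rewards are deterministic with values in `[0, 1]`. -/
structure MarkovGame (H : ℕ) where
  State : Fin (H + 1) → Type u
  ActMax : Fin H → Type v
  ActMin : Fin H → Type w
  [stateFintype : ∀ h, Fintype (State h)]
  [actMaxFintype : ∀ h, Fintype (ActMax h)]
  [actMinFintype : ∀ h, Fintype (ActMin h)]
  [actMaxNonempty : ∀ h, Nonempty (ActMax h)]
  [actMinNonempty : ∀ h, Nonempty (ActMin h)]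
  /-- the transition distribution `P_h(· | s, a, b)` -/
  trans : ∀ h : Fin H, State h.castSucc → ActMax h → ActMin h → PMF (State h.succ)
  /-- the reward `r_h(s, a, b)` -/
  reward : ∀ h : Fin H, State h.castSucc → ActMax h → ActMin h → ℝ
  reward_mem : ∀ h s a b, reward h s a b ∈ Set.Icc (0 : ℝ) 1

attribute [instance] MarkovGame.stateFintype MarkovGame.actMaxFintype MarkovGame.actMinFintype
  MarkovGame.actMaxNonempty MarkovGame.actMinNonempty

/-- Expectation of a real function under a discrete law. (It is used below only for laws with
finite support, where the series is a finite sum.) -/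
noncomputable def expect {α : Type*} (q : PMF α) (f : α → ℝ) : ℝ :=
  ∑' x, (q x).toReal * f x

/-- The bilinear payoff `φᵀ M ψ` of mixed actions `φ`, `ψ` in the matrix game `M`. -/
noncomputable def payoff {α β : Type*} [Fintype α] [Fintype β]
    (M : α → β → ℝ) (φ : PMF α) (ψ : PMF β) : ℝ :=
  ∑ a, ∑ b, (φ a).toReal * (ψ b).toReal * M a b

/-- `(φ, ψ)` is a Nash equilibrium of the general-sum game in which the row player maximizes
`M` and the column player minimizes `N`. -/
def IsNashEquilibrium {α β : Type*} [Fintype α] [Fintype β]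
    (M N : α → β → ℝ) (φ : PMF α) (ψ : PMF β) : Prop :=
  (∀ φ' : PMF α, payoff M φ' ψ ≤ payoff M φ ψ) ∧
    (∀ ψ' : PMF β, payoff N φ ψ ≤ payoff N φ ψ')

namespace MarkovGame

variable {H : ℕ} (G : MarkovGame.{u, v, w} H)

/-- Markov policies of the max-player. -/
abbrev MaxPolicy : Type (max u v) := ∀ h : Fin H, G.State h.castSucc → PMF (G.ActMax h)

/-- Markov policies of the min-player. -/
abbrev MinPolicy : Type (max u w) := ∀ h : Fin H, G.State h.castSucc → PMF (G.ActMin h)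

/-- What is observed in one step `h` of an episode: the state `s`, the actions `a`, `b`, the
reward `r` and the next state `s'`. -/
structure Obs where
  h : Fin H
  s : G.State h.castSucc
  a : G.ActMax h
  b : G.ActMin h
  r : ℝ
  s' : G.State h.succ

/-- The law of the observations from step `h` to the end of the episode, if the state at step `h`
is `s` and the players use the policies `μ` and `ν`. -/
noncomputable def episodeLaw (μ : G.MaxPolicy) (ν : G.MinPolicy) (h : Fin (H + 1)) :
    G.State h → PMF (List G.Obs) :=
  Fin.reverseInduction (motive := fun h => G.State h → PMF (List G.Obs))
    (fun _ => PMF.pure [])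
    (fun h next s =>
      (μ h s).bind fun a => (ν h s).bind fun b => (G.trans h s a b).bind fun s' =>
        (next s').map fun τ => ⟨h, s, a, b, G.reward h s a b, s'⟩ :: τ)
    h

/-- The cumulative reward along a list of observations. -/
def cumReward (τ : List G.Obs) : ℝ := (τ.map Obs.r).sum

/-- The value function `V_h^{μ,ν}(s)`: expected cumulative reward from step `h` on. -/
noncomputable def value (μ : G.MaxPolicy) (ν : G.MinPolicy) (h : Fin (H + 1)) (s : G.State h) :
    ℝ :=
  expect (G.episodeLaw μ ν h s) G.cumReward

/-- `V_1^{†,ν}(s)`: the value of `ν` against a best response of the max-player. -/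
noncomputable def valueMaxBest (ν : G.MinPolicy) (s : G.State 0) : ℝ :=
  ⨆ μ : G.MaxPolicy, G.value μ ν 0 s

/-- `V_1^{μ,†}(s)`: the value of `μ` against a best response of the min-player. -/
noncomputable def valueMinBest (μ : G.MaxPolicy) (s : G.State 0) : ℝ :=
  ⨅ ν : G.MinPolicy, G.value μ ν 0 s

/-- Type of a subroutine that maps the two payoff matrices of a general-sum matrix game to a pair
of mixed actions. -/
abbrev MatrixSolver : Type (max v w) :=
  ∀ h : Fin H, (G.ActMax h → G.ActMin h → ℝ) → (G.ActMax h → G.ActMin h → ℝ) →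
    PMF (G.ActMax h) × PMF (G.ActMin h)

variable {G} in
/-- The subroutine always returns a Nash equilibrium of the matrix game it is given. -/
def MatrixSolver.IsNash (nash : G.MatrixSolver) : Prop :=
  ∀ (h : Fin H) (M N : G.ActMax h → G.ActMin h → ℝ),
    IsNashEquilibrium M N (nash h M N).1 (nash h M N).2

section Data

open Classical in
/-- `N_h(s, a, b)`: number of visits in the data `D`. -/
noncomputable def count (D : List G.Obs) (h : Fin H) (s : G.State h.castSucc)
    (a : G.ActMax h) (b : G.ActMin h) : ℕ :=
  D.countP fun o => ∃ r s', o = ⟨h, s, a, b, r, s'⟩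

open Classical in
/-- `N_h(s, a, b, s')`: number of observed transitions to `s'` in the data `D`. -/
noncomputable def countNext (D : List G.Obs) (h : Fin H) (s : G.State h.castSucc)
    (a : G.ActMax h) (b : G.ActMin h) (s' : G.State h.succ) : ℕ :=
  D.countP fun o => ∃ r, o = ⟨h, s, a, b, r, s'⟩

open Classical in
/-- The reward estimate: the most recent reward observed at `(h, s, a, b)`
(`0` before the first visit, where it is never used). -/
noncomputable def rewardEst (D : List G.Obs) (h : Fin H) (s : G.State h.castSucc)
    (a : G.ActMax h) (b : G.ActMin h) : ℝ :=
  ((D.reverse.find? fun o => ∃ r s', o = ⟨h, s, a, b, r, s'⟩).map Obs.r).getD 0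

/-- `[P̂_h V](s, a, b)` for the empirical transition matrix `P̂_h` of the data `D`. -/
noncomputable def transEst (D : List G.Obs) (h : Fin H) (V : G.State h.succ → ℝ)
    (s : G.State h.castSucc) (a : G.ActMax h) (b : G.ActMin h) : ℝ :=
  ∑ s', (G.countNext D h s a b s' : ℝ) / (G.count D h s a b : ℝ) * V s'

/-- The upper estimate `Q_h^up`, given the upper estimate `V` of the value at the next step. -/
noncomputable def qUp (bonus : ℕ → ℝ) (D : List G.Obs) (h : Fin H) (V : G.State h.succ → ℝ)
    (s : G.State h.castSucc) (a : G.ActMax h) (b : G.ActMin h) : ℝ :=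
  if G.count D h s a b = 0 then (H : ℝ)
  else min (G.rewardEst D h s a b + G.transEst D h V s a b + bonus (G.count D h s a b)) H

/-- The lower estimate `Q_h^low`, given the lower estimate `V` of the value at the next step. -/
noncomputable def qLow (bonus : ℕ → ℝ) (D : List G.Obs) (h : Fin H) (V : G.State h.succ → ℝ)
    (s : G.State h.castSucc) (a : G.ActMax h) (b : G.ActMin h) : ℝ :=
  if G.count D h s a b = 0 then 0
  else max (G.rewardEst D h s a b + G.transEst D h V s a b - bonus (G.count D h s a b)) 0

/-- The pair `(V_h^up(s), V_h^low(s))`, computed backwards from the end of the episode. -/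
noncomputable def vUpLow (nash : G.MatrixSolver) (bonus : ℕ → ℝ) (D : List G.Obs)
    (h : Fin (H + 1)) : G.State h → ℝ × ℝ :=
  Fin.reverseInduction (motive := fun h => G.State h → ℝ × ℝ)
    (fun _ => (0, 0))
    (fun h V s =>
      let Qup := G.qUp bonus D h (fun s' => (V s').1) s
      let Qlow := G.qLow bonus D h (fun s' => (V s').2) s
      let e := nash h Qup Qlow
      (payoff Qup e.1 e.2, payoff Qlow e.1 e.2))
    h

/-- The pair of mixed actions that VI-ULCB uses at step `h` in state `s` in an episode that
starts with the data `D`: the equilibrium of the general-sum game `(Q_h^up(s), Q_h^low(s))`. -/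
noncomputable def ulcbActions (nash : G.MatrixSolver) (bonus : ℕ → ℝ) (D : List G.Obs)
    (h : Fin H) (s : G.State h.castSucc) : PMF (G.ActMax h) × PMF (G.ActMin h) :=
  nash h (G.qUp bonus D h (fun s' => (G.vUpLow nash bonus D h.succ s').1) s)
    (G.qLow bonus D h (fun s' => (G.vUpLow nash bonus D h.succ s').2) s)

/-- The max-player's policy computed by VI-ULCB from the data `D`. -/
noncomputable def ulcbMax (nash : G.MatrixSolver) (bonus : ℕ → ℝ) (D : List G.Obs) :
    G.MaxPolicy := fun h s => (G.ulcbActions nash bonus D h s).1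

/-- The min-player's policy computed by VI-ULCB from the data `D`. -/
noncomputable def ulcbMin (nash : G.MatrixSolver) (bonus : ℕ → ℝ) (D : List G.Obs) :
    G.MinPolicy := fun h s => (G.ulcbActions nash bonus D h s).2

end Data

/-- The law of the trajectories (in chronological order) of the first `k` episodes of VI-ULCB,
when every episode starts in `s₁`. -/
noncomputable def ulcbRun (nash : G.MatrixSolver) (bonus : ℕ → ℝ) (s₁ : G.State 0) :
    ℕ → PMF (List (List G.Obs))
  | 0 => PMF.pure []
  | k + 1 => (ulcbRun nash bonus s₁ k).bind fun hist =>
      (G.episodeLaw (G.ulcbMax nash bonus hist.flatten) (G.ulcbMin nash bonus hist.flatten)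
        0 s₁).map fun τ => hist ++ [τ]

/-- The max-player's policy deployed in episode `k` (counted from `0`), if `hist` is the list of
the trajectories of all episodes: it is computed from the first `k` of them. -/
noncomputable def deployedMax (nash : G.MatrixSolver) (bonus : ℕ → ℝ)
    (hist : List (List G.Obs)) (k : ℕ) : G.MaxPolicy :=
  G.ulcbMax nash bonus (hist.take k).flatten

/-- The min-player's policy deployed in episode `k` (counted from `0`). -/
noncomputable def deployedMin (nash : G.MatrixSolver) (bonus : ℕ → ℝ)
    (hist : List (List G.Obs)) (k : ℕ) : G.MinPolicy :=
  G.ulcbMin nash bonus (hist.take k).flatten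

end MarkovGame

/-- The bonus `β_t = c √(H² S ι / t)` with `ι = log (S A B T / p)` and `T = K H`. -/
noncomputable def ulcbBonus (c : ℝ) (H S A B K : ℕ) (p : ℝ) (t : ℕ) : ℝ :=
  c * Real.sqrt ((H : ℝ) ^ 2 * S * Real.log ((S : ℝ) * A * B * (K * H) / p) / t)

/-- A joint law of a pair of indices, each of which is uniform on `{0, …, K - 1}`. -/
def IsUniformSampling {K : ℕ} (q : PMF (Fin K × Fin K)) : Prop :=
  (∀ i, q.map Prod.fst i = (K : ℝ≥0∞)⁻¹) ∧ (∀ j, q.map Prod.snd j = (K : ℝ≥0∞)⁻¹)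

/-! The proof combines optimism with a pigeonhole count. On an event of high probability the
empirical transition frequencies of every set of next states are accurate (`Concentrated`). Since
`E` ranges over all subsets, this controls `P̂V - PV` simultaneously for all `V` with values in `[0,
H]`, including the value estimates that depend on the data; the union over `2 ^ S` sets is what puts
the factor `S` under the root in the bonus.

On this event the two inequalities that define a Nash equilibrium give `V^{μ,ν^k} ≤ V^up` for every
`μ` and `V^low ≤ V^{μ^k,ν}` for every `ν` (`value_le_vUp`, `vLow_le_value`). No other property of
the equilibrium is needed, so the choice of subroutine is irrelevant. The duality gap of `(μ^k,
ν^k)` is therefore at most `V^up - V^low`, and this is at most the expected sum of confidence widths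
along the next episode (`duality_gap_le`).

A multiplicative Chernoff bound replaces these conditional expectations by twice the realized widths
plus `2 H² log (2 / p)`. A triple `(s, a, b)` of a given step is visited at most once per episode,
so the realized widths sum to `∑ H + O(w √n)` over at most `HSAB` triples, `n` being the number of
visits and `w` of order `√(H² S L)`, where `L` is the logarithm in the bonus. Cauchy–Schwarz with
`KH` visits in total gives a regret of order `H² SAB + √(H⁴ S² A B K L)` plus the Chernoff term
(`sum_gap_le`). The condition on `K` makes this at most `Kε` (`mul_log_le_of_le`). Finally, the
sampled gap splits into a term in `ν̂` and a term in `μ̂`, so its expectation is the average gap for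
every coupling. -/

/-- Expectation of an extended nonnegative function under a discrete law. -/
noncomputable def lexp {α : Type*} (q : PMF α) (F : α → ℝ≥0∞) : ℝ≥0∞ := ∑' x, q x * F x

/-! ### Expectations under discrete laws and one-variable exponential bounds. -/

section Expectation

variable {α β : Type*}

/-- Tonelli. With values in `ℝ≥0∞` no summability has to be tracked, which is why the law of the
whole run is only ever integrated with `lexp`. -/
theorem lexp_bind (q : PMF α) (k : α → PMF β) (F : β → ℝ≥0∞) :
    lexp (q.bind k) F = lexp q fun x => lexp (k x) F := by
  simp only [lexp, PMF.bind_apply, ← ENNReal.tsum_mul_right, ← ENNReal.tsum_mul_left]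
  rw [ENNReal.tsum_comm]
  simp only [mul_assoc]

theorem lexp_pure (x : α) (F : α → ℝ≥0∞) : lexp (PMF.pure x) F = F x := by
  rw [lexp, tsum_eq_single x]
  · simp
  · intro y hy
    simp [PMF.pure_apply, hy]

theorem lexp_map (q : PMF α) (g : α → β) (F : β → ℝ≥0∞) :
    lexp (q.map g) F = lexp q fun x => F (g x) := by
  rw [← PMF.bind_pure_comp, lexp_bind]
  simp [lexp_pure]

theorem lexp_mono {q : PMF α} {F F' : α → ℝ≥0∞} (h : ∀ x ∈ q.support, F x ≤ F' x) :
    lexp q F ≤ lexp q F' := by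
  refine ENNReal.tsum_le_tsum fun x => ?_
  by_cases hx : x ∈ q.support
  · gcongr
    exact h x hx
  · rw [PMF.mem_support_iff, not_not] at hx
    simp [hx]

theorem lexp_const_mul (q : PMF α) (c : ℝ≥0∞) (F : α → ℝ≥0∞) :
    lexp q (fun x => c * F x) = c * lexp q F := by
  simp only [lexp, ← ENNReal.tsum_mul_left]
  congr 1 with x
  ring

theorem lexp_const (q : PMF α) (c : ℝ≥0∞) : lexp q (fun _ => c) = c := by
  rw [lexp, ENNReal.tsum_mul_right, q.tsum_coe, one_mul]

theorem lexp_le_of_le {q : PMF α} {F : α → ℝ≥0∞} {c : ℝ≥0∞} (h : ∀ x ∈ q.support, F x ≤ c) :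
    lexp q F ≤ c :=
  (lexp_mono h).trans (lexp_const q c).le

/-- Markov's inequality. -/
theorem toOuterMeasure_le_lexp (q : PMF α) (s : Set α) (F : α → ℝ≥0∞)
    (h : ∀ x ∈ s, x ∈ q.support → 1 ≤ F x) : q.toOuterMeasure s ≤ lexp q F := by
  rw [PMF.toOuterMeasure_apply]
  refine ENNReal.tsum_le_tsum fun x => ?_
  by_cases hx : x ∈ s
  · rw [Set.indicator_of_mem hx]
    by_cases hq : x ∈ q.support
    · exact le_mul_of_one_le_right' (h x hx hq)
    · rw [PMF.mem_support_iff, not_not] at hq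
      simp [hq]
  · simp [hx]

/-- The conclusion has the same form as the hypothesis, so the union bound can be nested over
indices of dependent type. -/
theorem toOuterMeasure_exists_le {ι : Type*} [Fintype ι] (q : PMF α) (P : ι → α → Prop)
    {c : ℝ} (h : ∀ i, q.toOuterMeasure {x | P i x} ≤ ENNReal.ofReal c) {n : ℕ}
    (hn : Fintype.card ι ≤ n) :
    q.toOuterMeasure {x | ∃ i, P i x} ≤ ENNReal.ofReal (n * c) := by
  have : {x | ∃ i, P i x} = ⋃ i, {x | P i x} := by ext; simp
  rw [this]
  refine (MeasureTheory.measure_iUnion_fintype_le _ _).trans ?_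
  refine (Finset.sum_le_sum fun i _ => h i).trans ?_
  rw [Finset.sum_const, Finset.card_univ, nsmul_eq_mul, ENNReal.ofReal_mul (by positivity),
    ENNReal.ofReal_natCast]
  gcongr

theorem expect_eq_sum [Fintype α] (q : PMF α) (f : α → ℝ) :
    expect q f = ∑ x, (q x).toReal * f x :=
  tsum_fintype _

theorem sum_toReal_eq_one [Fintype α] (q : PMF α) : ∑ x, (q x).toReal = 1 := by
  rw [← ENNReal.toReal_sum fun x _ => q.apply_ne_top x, ← tsum_fintype (L := .unconditional α),
    q.tsum_coe, ENNReal.toReal_one]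

theorem summable_of_finite {q : PMF α} (hq : q.support.Finite) (f : α → ℝ) :
    Summable fun x => (q x).toReal * f x := by
  refine summable_of_hasFiniteSupport (hq.subset fun x hx => ?_)
  rw [PMF.mem_support_iff]
  rintro h
  simp [h] at hx

theorem expect_const (q : PMF α) (c : ℝ) : expect q (fun _ => c) = c := by
  rw [expect, tsum_mul_right, ← ENNReal.tsum_toReal_eq fun x => q.apply_ne_top x, q.tsum_coe]
  simp

theorem expect_mono {q : PMF α} (hq : q.support.Finite) {f g : α → ℝ}
    (h : ∀ x ∈ q.support, f x ≤ g x) : expect q f ≤ expect q g := by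
  refine (summable_of_finite hq f).tsum_le_tsum (fun x => ?_) (summable_of_finite hq g)
  by_cases hx : x ∈ q.support
  · exact mul_le_mul_of_nonneg_left (h x hx) ENNReal.toReal_nonneg
  · rw [PMF.mem_support_iff, not_not] at hx
    simp [hx]

theorem expect_add {q : PMF α} (hq : q.support.Finite) (f g : α → ℝ) :
    expect q (fun x => f x + g x) = expect q f + expect q g := by
  simp only [expect, mul_add]
  exact (summable_of_finite hq f).tsum_add (summable_of_finite hq g)

theorem expect_const_mul (q : PMF α) (c : ℝ) (f : α → ℝ) :
    expect q (fun x => c * f x) = c * expect q f := by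
  simp only [expect, ← tsum_mul_left]
  congr 1 with x
  ring

theorem lexp_ofReal {q : PMF α} (hq : q.support.Finite) {f : α → ℝ} (hf : ∀ x, 0 ≤ f x) :
    lexp q (fun x => ENNReal.ofReal (f x)) = ENNReal.ofReal (expect q f) := by
  rw [expect, ENNReal.ofReal_tsum_of_nonneg (fun x => mul_nonneg ENNReal.toReal_nonneg (hf x))
    (summable_of_finite hq f), lexp]
  congr 1 with x
  rw [ENNReal.ofReal_mul ENNReal.toReal_nonneg, ENNReal.ofReal_toReal (q.apply_ne_top x)]

theorem expect_pure (x : α) (f : α → ℝ) : expect (PMF.pure x) f = f x := by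
  rw [expect, tsum_eq_single x]
  · simp
  · intro y hy
    simp [PMF.pure_apply, hy]

theorem expect_bind [Fintype α] (q : PMF α) (k : α → PMF β) (hk : ∀ x, (k x).support.Finite)
    (f : β → ℝ) : expect (q.bind k) f = ∑ x, (q x).toReal * expect (k x) f := by
  simp only [expect, PMF.bind_apply, tsum_fintype, ← tsum_mul_left]
  rw [← Summable.tsum_finsetSum fun x _ => (summable_of_finite (hk x) f).mul_left _]
  congr 1 with y
  rw [ENNReal.toReal_sum fun x _ => ENNReal.mul_ne_top (q.apply_ne_top x) ((k x).apply_ne_top y),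
    Finset.sum_mul]
  simp [mul_assoc]

theorem expect_map_of_injective (q : PMF α) {g : α → β} (hg : g.Injective) (f : β → ℝ) :
    expect (q.map g) f = expect q fun x => f (g x) := by
  have h : ∀ x, q.map g (g x) = q x := by
    intro x
    rw [PMF.map_apply, tsum_eq_single x]
    · simp
    · intro y hy
      simp [hg.ne hy.symm]
  rw [expect, ← hg.tsum_eq]
  · simp [expect, h]
  · intro y hy
    by_contra hn
    have : y ∉ (q.map g).support := by
      rw [PMF.support_map]
      rintro ⟨x, -, rfl⟩
      exact hn ⟨x, rfl⟩
    rw [PMF.mem_support_iff, not_not] at this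
    exact hy (by simp [this, -PMF.map_apply])

theorem bind_support_finite [Finite α] (q : PMF α) (k : α → PMF β)
    (hk : ∀ x, (k x).support.Finite) : (q.bind k).support.Finite := by
  rw [PMF.support_bind]
  exact (Set.toFinite _).biUnion fun x _ => hk x

/-- The multiplicative Chernoff bound for one variable with values in `[0, 1]`. -/
theorem lexp_exp_neg_le {q : PMF α} (hq : q.support.Finite) {f : α → ℝ}
    (hf : ∀ x ∈ q.support, f x ∈ Set.Icc (0 : ℝ) 1) :
    lexp q (fun x => ENNReal.ofReal (Real.exp (-f x))) ≤
      ENNReal.ofReal (Real.exp (-(expect q f / 2))) := by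
  rw [lexp_ofReal hq fun x => (Real.exp_pos _).le]
  refine ENNReal.ofReal_le_ofReal ?_
  have h1 : expect q (fun x => Real.exp (-f x)) ≤ expect q (fun x => 1 + (-(1 / 2)) * f x) := by
    refine expect_mono hq fun x hx => ?_
    obtain ⟨h0, h1⟩ := hf x hx
    -- The chord of `exp` over `[-1, 0]` gives `exp (-f) ≤ 1 - (1 - e⁻¹) f`, and `e⁻¹ ≤ 1/2`.
    have h3 := convexOn_exp.2 (Set.mem_univ (0 : ℝ)) (Set.mem_univ (-1 : ℝ))
      (sub_nonneg.2 h1) h0 (by ring)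
    simp only [smul_eq_mul, mul_zero, Real.exp_zero, zero_add, mul_one, mul_neg] at h3
    have h4 : Real.exp (-1) ≤ 1 / 2 := by
      have := Real.exp_neg_one_lt_d9
      linarith
    nlinarith
  refine h1.trans ?_
  rw [expect_add hq, expect_const, expect_const_mul]
  have := Real.add_one_le_exp (-(expect q f / 2))
  linarith

/-- Hoeffding's lemma for the indicator of a finite set. -/
theorem lexp_indicator_le [Fintype α] [DecidableEq α] (q : PMF α) (s : Finset α) (l : ℝ) :
    lexp q (fun x => ENNReal.ofReal (Real.exp
      (l * ((if x ∈ s then 1 else 0) - ∑ y ∈ s, (q y).toReal) - l ^ 2 / 2))) ≤ 1 := by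
  rw [lexp_ofReal (Set.toFinite _) fun x => (Real.exp_pos _).le, ← ENNReal.ofReal_one]
  refine ENNReal.ofReal_le_ofReal ?_
  set m := ∑ y ∈ s, (q y).toReal with hm
  have hsum := sum_toReal_eq_one q
  have hm0 : 0 ≤ m := Finset.sum_nonneg fun _ _ => ENNReal.toReal_nonneg
  have hm1 : m ≤ 1 := hsum ▸ Finset.sum_le_univ_sum_of_nonneg fun _ => ENNReal.toReal_nonneg
  have h1 : expect q (fun x => Real.exp
      (l * ((if x ∈ s then 1 else 0) - m) - l ^ 2 / 2)) ≤
      expect q (fun x => Real.exp (-(l ^ 2 / 2)) * (Real.cosh l +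
        Real.sinh l * ((if x ∈ s then 1 else 0) - m))) := by
    refine expect_mono (Set.toFinite _) fun x _ => ?_
    set z : ℝ := (if x ∈ s then 1 else 0) - m with hz
    have hz1 : -1 ≤ z ∧ z ≤ 1 := by
      rw [hz]; split_ifs <;> constructor <;> linarith
    rw [show l * z - l ^ 2 / 2 = -(l ^ 2 / 2) + l * z by ring, Real.exp_add]
    refine mul_le_mul_of_nonneg_left ?_ (Real.exp_pos _).le
    -- The chord over `[-l, l]` only uses `|z| ≤ 1`; this yields `l² / 2` instead of the sharp `l² /
    -- 8`, which costs only a constant.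
    have h3 := convexOn_exp.2 (Set.mem_univ (-l : ℝ)) (Set.mem_univ (l : ℝ))
      (show 0 ≤ (1 - z) / 2 by linarith) (show 0 ≤ (1 + z) / 2 by linarith) (by ring)
    simp only [smul_eq_mul] at h3
    rw [Real.cosh_eq, Real.sinh_eq]
    rw [show (1 - z) / 2 * -l + (1 + z) / 2 * l = l * z by ring] at h3
    linarith
  refine h1.trans ?_
  rw [expect_const_mul, expect_add (Set.toFinite _), expect_const, expect_const_mul]
  have h2 : expect q (fun x => (if x ∈ s then (1 : ℝ) else 0) - m) = 0 := by
    rw [expect_eq_sum]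
    simp only [mul_sub, mul_ite, mul_one, mul_zero, Finset.sum_sub_distrib, ← Finset.sum_mul,
      hsum, Finset.sum_ite_mem, Finset.univ_inter]
    rw [← hm]; ring
  rw [h2, mul_zero, add_zero]
  calc Real.exp (-(l ^ 2 / 2)) * Real.cosh l ≤ Real.exp (-(l ^ 2 / 2)) * Real.exp (l ^ 2 / 2) := by
        gcongr; exact Real.cosh_le_exp_half_sq l
    _ = 1 := by rw [← Real.exp_add]; simp

end Expectation

namespace MarkovGame

variable {H : ℕ} (G : MarkovGame.{u, v, w} H)

/-! ### The law of one episode and the Bellman recursion. -/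

section EpisodeLaw

variable (μ : G.MaxPolicy) (ν : G.MinPolicy)

theorem episodeLaw_last (s : G.State (Fin.last H)) :
    G.episodeLaw μ ν (Fin.last H) s = PMF.pure [] := by
  simp [episodeLaw]

theorem episodeLaw_castSucc (h : Fin H) (s : G.State h.castSucc) :
    G.episodeLaw μ ν h.castSucc s =
      (μ h s).bind fun a => (ν h s).bind fun b => (G.trans h s a b).bind fun s' =>
        (G.episodeLaw μ ν h.succ s').map fun τ => ⟨h, s, a, b, G.reward h s a b, s'⟩ :: τ := by
  simp [episodeLaw]

theorem mem_support_episodeLaw_castSucc {h : Fin H} {s : G.State h.castSucc} {τ : List G.Obs} :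
    τ ∈ (G.episodeLaw μ ν h.castSucc s).support ↔
      ∃ a ∈ (μ h s).support, ∃ b ∈ (ν h s).support, ∃ s' ∈ (G.trans h s a b).support,
        ∃ τ' ∈ (G.episodeLaw μ ν h.succ s').support,
          ⟨h, s, a, b, G.reward h s a b, s'⟩ :: τ' = τ := by
  simp only [episodeLaw_castSucc, PMF.mem_support_bind_iff, PMF.mem_support_map_iff]

theorem episodeLaw_support_finite (h : Fin (H + 1)) :
    ∀ s : G.State h, (G.episodeLaw μ ν h s).support.Finite := by
  induction h using Fin.reverseInduction with
  | last => intro s; rw [episodeLaw_last, PMF.support_pure]; exact Set.finite_singleton _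
  | cast h ih =>
    intro s
    rw [episodeLaw_castSucc]
    refine bind_support_finite _ _ fun a => bind_support_finite _ _ fun b =>
      bind_support_finite _ _ fun s' => ?_
    rw [PMF.support_map]
    exact (ih s').image _

/-- The expectation of a sum of a function of the observations. -/
noncomputable def expectSum (f : G.Obs → ℝ) (h : Fin (H + 1)) (s : G.State h) : ℝ :=
  expect (G.episodeLaw μ ν h s) fun τ => (τ.map f).sum

theorem expectSum_last (f : G.Obs → ℝ) (s : G.State (Fin.last H)) :
    G.expectSum μ ν f (Fin.last H) s = 0 := by
  simp [expectSum, episodeLaw_last, expect_pure]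

/-- The Bellman recursion for an arbitrary additive functional: it serves both the value function
(`f = Obs.r`) and the expected confidence widths (`f = obsWidth`). -/
theorem expectSum_castSucc (f : G.Obs → ℝ) (h : Fin H) (s : G.State h.castSucc) :
    G.expectSum μ ν f h.castSucc s = ∑ a, ∑ b, (μ h s a).toReal * (ν h s b).toReal *
      ∑ s', (G.trans h s a b s').toReal *
        (f ⟨h, s, a, b, G.reward h s a b, s'⟩ + G.expectSum μ ν f h.succ s') := by
  have hfin : ∀ a b s', ((G.episodeLaw μ ν h.succ s').map fun τ =>
      (⟨h, s, a, b, G.reward h s a b, s'⟩ : G.Obs) :: τ).support.Finite := fun a b s' => by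
    rw [PMF.support_map]
    exact (G.episodeLaw_support_finite μ ν h.succ s').image _
  rw [expectSum, episodeLaw_castSucc, expect_bind _ _ fun a => bind_support_finite _ _ fun b =>
    bind_support_finite _ _ fun s' => hfin a b s']
  refine Finset.sum_congr rfl fun a _ => ?_
  rw [expect_bind _ _ fun b => bind_support_finite _ _ fun s' => hfin a b s', Finset.mul_sum]
  refine Finset.sum_congr rfl fun b _ => ?_
  rw [expect_bind _ _ fun s' => hfin a b s', ← mul_assoc]
  congr 1
  refine Finset.sum_congr rfl fun s' _ => ?_
  rw [expect_map_of_injective _ (List.cons_injective)]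
  simp only [List.map_cons, List.sum_cons]
  rw [expect_add (G.episodeLaw_support_finite μ ν h.succ s'), expect_const, expectSum]

theorem value_eq_expectSum (h : Fin (H + 1)) (s : G.State h) :
    G.value μ ν h s = G.expectSum μ ν Obs.r h s := rfl

theorem lexp_episodeLaw_castSucc (h : Fin H) (s : G.State h.castSucc) (F : List G.Obs → ℝ≥0∞) :
    lexp (G.episodeLaw μ ν h.castSucc s) F =
      lexp (μ h s) fun a => lexp (ν h s) fun b => lexp (G.trans h s a b) fun s' =>
        lexp (G.episodeLaw μ ν h.succ s') fun τ =>
          F (⟨h, s, a, b, G.reward h s a b, s'⟩ :: τ) := by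
  simp only [episodeLaw_castSucc, lexp_bind, lexp_map]

/-- What holds for every trajectory from step `h` on: the observed rewards are correct, and the
steps `h`, `h + 1`, …, `H - 1` are visited once each. -/
theorem episodeLaw_support (h : Fin (H + 1)) :
    ∀ (s : G.State h), ∀ τ ∈ (G.episodeLaw μ ν h s).support,
      (∀ o ∈ τ, o.r = G.reward o.h o.s o.a o.b) ∧ (∀ o ∈ τ, h ≤ o.h.castSucc) ∧
        τ.Pairwise (fun o o' => o.h ≠ o'.h) ∧ τ.length + h = H := by
  induction h using Fin.reverseInduction with
  | last =>
    intro s τ hτ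
    rw [episodeLaw_last, PMF.mem_support_pure_iff] at hτ
    subst hτ
    simp
  | cast h ih =>
    intro s τ hτ
    rw [mem_support_episodeLaw_castSucc] at hτ
    obtain ⟨a, -, b, -, s', -, τ', hτ', rfl⟩ := hτ
    obtain ⟨h1, h2, h3, h4⟩ := ih s' τ' hτ'
    refine ⟨?_, ?_, ?_, ?_⟩
    · intro o ho
      rcases List.mem_cons.1 ho with rfl | ho
      · rfl
      · exact h1 o ho
    · intro o ho
      rcases List.mem_cons.1 ho with rfl | ho
      · exact le_rfl
      · exact Fin.castSucc_lt_succ.le.trans (h2 o ho)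
    · refine List.pairwise_cons.2 ⟨fun o ho he => ?_, h3⟩
      have := h2 o ho
      rw [← he] at this
      exact absurd this (not_le.2 Fin.castSucc_lt_succ)
    · simp only [List.length_cons, Fin.val_castSucc, Fin.val_succ] at h4 ⊢
      omega

end EpisodeLaw

/-! ### Bilinear payoffs and the range of value functions. -/

section Payoff

variable {α β : Type*} [Fintype α] [Fintype β] {M N : α → β → ℝ} (φ : PMF α) (ψ : PMF β)

theorem payoff_mono (h : ∀ a b, M a b ≤ N a b) : payoff M φ ψ ≤ payoff N φ ψ :=
  Finset.sum_le_sum fun a _ => Finset.sum_le_sum fun b _ =>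
    mul_le_mul_of_nonneg_left (h a b) (mul_nonneg ENNReal.toReal_nonneg ENNReal.toReal_nonneg)

theorem payoff_const (c : ℝ) : payoff (fun _ _ => c) φ ψ = c := by
  simp only [payoff, ← Finset.sum_mul, ← Finset.mul_sum, sum_toReal_eq_one, mul_one, one_mul]

theorem payoff_sub : payoff (fun a b => M a b - N a b) φ ψ = payoff M φ ψ - payoff N φ ψ := by
  simp only [payoff, mul_sub, Finset.sum_sub_distrib]

end Payoff

theorem value_castSucc (μ : G.MaxPolicy) (ν : G.MinPolicy) (h : Fin H) (s : G.State h.castSucc) :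
    G.value μ ν h.castSucc s = payoff (fun a b => G.reward h s a b +
      ∑ s', (G.trans h s a b s').toReal * G.value μ ν h.succ s') (μ h s) (ν h s) := by
  simp only [value_eq_expectSum, expectSum_castSucc, payoff, mul_add, Finset.sum_add_distrib,
    ← Finset.sum_mul, sum_toReal_eq_one, one_mul]

theorem value_mem (μ : G.MaxPolicy) (ν : G.MinPolicy) (h : Fin (H + 1)) :
    ∀ s, G.value μ ν h s ∈ Set.Icc (0 : ℝ) (H - h) := by
  induction h using Fin.reverseInduction with
  | last => intro s; rw [value_eq_expectSum, expectSum_last]; simp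
  | cast h ih =>
    intro s
    rw [value_castSucc]
    constructor
    · rw [← payoff_const (μ h s) (ν h s) 0]
      refine payoff_mono _ _ fun a b => add_nonneg (G.reward_mem h s a b).1 ?_
      exact Finset.sum_nonneg fun s' _ => mul_nonneg ENNReal.toReal_nonneg (ih s').1
    · rw [← payoff_const (μ h s) (ν h s) ((H : ℝ) - h.castSucc)]
      refine payoff_mono _ _ fun a b => ?_
      have h1 : ∑ s', (G.trans h s a b s').toReal * G.value μ ν h.succ s' ≤
          ∑ s', (G.trans h s a b s').toReal * ((H : ℝ) - h.succ) :=
        Finset.sum_le_sum fun s' _ => mul_le_mul_of_nonneg_left (ih s').2 ENNReal.toReal_nonneg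
      rw [← Finset.sum_mul, sum_toReal_eq_one, one_mul] at h1
      have h2 := (G.reward_mem h s a b).2
      simp only [Fin.val_succ, Fin.val_castSucc, Nat.cast_add, Nat.cast_one] at h1 ⊢
      linarith

/-! ### Visit counts and reward estimates. -/

section Data

/-- The index set of the triples `(s, a, b)` of all steps. -/
abbrev Idx : Type (max u v w) := Σ h : Fin H, G.State h.castSucc × G.ActMax h × G.ActMin h

variable {G} in
/-- The state-action triple of an observation. -/
def Obs.idx (o : G.Obs) : G.Idx := ⟨o.h, o.s, o.a, o.b⟩

/-- Passing to one equation in a sigma type removes the dependent fields, so that visits become a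
`List.count`. -/
theorem exists_eq_iff_idx (h : Fin H) (s : G.State h.castSucc) (a : G.ActMax h) (b : G.ActMin h)
    (o : G.Obs) : (∃ r s', o = ⟨h, s, a, b, r, s'⟩) ↔ o.idx = ⟨h, s, a, b⟩ := by
  constructor
  · rintro ⟨r, s', rfl⟩
    rfl
  · obtain ⟨h', s₀, a', b', r, s'⟩ := o
    intro hi
    simp only [Obs.idx, Sigma.mk.injEq] at hi
    obtain ⟨rfl, hi⟩ := hi
    simp only [heq_eq_eq, Prod.mk.injEq] at hi
    obtain ⟨rfl, rfl, rfl⟩ := hi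
    exact ⟨r, s', rfl⟩

open Classical in
theorem count_eq (D : List G.Obs) (h : Fin H) (s : G.State h.castSucc)
    (a : G.ActMax h) (b : G.ActMin h) :
    G.count D h s a b = (D.map Obs.idx).count ⟨h, s, a, b⟩ := by
  rw [count, List.count, List.countP_map]
  refine List.countP_congr fun o _ => ?_
  simp [exists_eq_iff_idx]

theorem count_append (D D' : List G.Obs) (h : Fin H) (s : G.State h.castSucc)
    (a : G.ActMax h) (b : G.ActMin h) :
    G.count (D ++ D') h s a b = G.count D h s a b + G.count D' h s a b := by
  simp [count]

/-- The number of observed transitions from `(s, a, b)` into the set `E`. -/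
noncomputable def countIn (D : List G.Obs) (h : Fin H) (s : G.State h.castSucc)
    (a : G.ActMax h) (b : G.ActMin h) (E : Finset (G.State h.succ)) : ℕ :=
  ∑ s' ∈ E, G.countNext D h s a b s'

theorem countIn_univ (D : List G.Obs) (h : Fin H) (s : G.State h.castSucc)
    (a : G.ActMax h) (b : G.ActMin h) :
    G.countIn D h s a b Finset.univ = G.count D h s a b := by
  classical
  induction D with
  | nil => simp [countIn, countNext, count]
  | cons o D ih =>
    rw [countIn, count, List.countP_cons] at *
    simp only [countNext, List.countP_cons, Finset.sum_add_distrib] at *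
    rw [ih]
    congr 1
    by_cases ho : ∃ r s', o = ⟨h, s, a, b, r, s'⟩
    · obtain ⟨r, s', rfl⟩ := ho
      simp
    · rw [if_neg (by simpa using ho)]
      refine Finset.sum_eq_zero fun s' _ => if_neg ?_
      simp only [decide_eq_true_eq]
      rintro ⟨r, hr⟩
      exact ho ⟨r, s', hr⟩

/-- The observed rewards are the true ones. -/
def RewardsValid (D : List G.Obs) : Prop := ∀ o ∈ D, o.r = G.reward o.h o.s o.a o.b

variable {G} in
theorem RewardsValid.rewardEst_eq {D : List G.Obs} (hD : G.RewardsValid D) {h : Fin H}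
    {s : G.State h.castSucc} {a : G.ActMax h} {b : G.ActMin h} (hc : G.count D h s a b ≠ 0) :
    G.rewardEst D h s a b = G.reward h s a b := by
  classical
  rw [rewardEst]
  cases hf : D.reverse.find? fun o => ∃ r s', o = ⟨h, s, a, b, r, s'⟩ with
  | none =>
    exfalso
    apply hc
    rw [count, List.countP_eq_zero]
    intro o ho
    rw [List.find?_eq_none] at hf
    exact hf o (List.mem_reverse.2 ho)
  | some o =>
    have h1 := List.find?_some hf
    have h2 := hD o (List.mem_reverse.1 (List.mem_of_find?_eq_some hf))
    simp only [decide_eq_true_eq] at h1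
    obtain ⟨r, s', rfl⟩ := h1
    exact h2

end Data

/-! ### The exponential supermartingale and the concentration event. -/

section Concentration

variable (h₀ : Fin H) (s₀ : G.State h₀.castSucc) (a₀ : G.ActMax h₀) (b₀ : G.ActMin h₀)

/-- The probability of a transition from `(s₀, a₀, b₀)` into `E`. -/
noncomputable def transProb (E : Finset (G.State h₀.succ)) : ℝ :=
  ∑ s' ∈ E, (G.trans h₀ s₀ a₀ b₀ s').toReal

variable (E : Finset (G.State h₀.succ)) (l : ℝ)

/-- The exponent of Hoeffding's supermartingale for the transitions from `(s₀, a₀, b₀)` into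
`E`. -/
noncomputable def devExp (D : List G.Obs) : ℝ :=
  l * (G.countIn D h₀ s₀ a₀ b₀ E - G.count D h₀ s₀ a₀ b₀ * G.transProb h₀ s₀ a₀ b₀ E) -
    G.count D h₀ s₀ a₀ b₀ * (l ^ 2 / 2)

theorem devExp_append (D D' : List G.Obs) :
    G.devExp h₀ s₀ a₀ b₀ E l (D ++ D') =
      G.devExp h₀ s₀ a₀ b₀ E l D + G.devExp h₀ s₀ a₀ b₀ E l D' := by
  simp only [devExp, count_append, countIn, countNext, List.countP_append, Finset.sum_add_distrib,
    Nat.cast_add]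
  ring

theorem devExp_nil : G.devExp h₀ s₀ a₀ b₀ E l [] = 0 := by
  simp [devExp, count, countIn, countNext]

/-- At the triple in question this is Hoeffding's lemma; an observation of any other triple leaves
the exponent at zero. -/
theorem lexp_devExp_singleton_le (h : Fin H) (s : G.State h.castSucc) (a : G.ActMax h)
    (b : G.ActMin h) :
    lexp (G.trans h s a b) (fun s' => ENNReal.ofReal (Real.exp
      (G.devExp h₀ s₀ a₀ b₀ E l [⟨h, s, a, b, G.reward h s a b, s'⟩]))) ≤ 1 := by
  classical
  by_cases hi : (⟨h, s, a, b⟩ : G.Idx) = ⟨h₀, s₀, a₀, b₀⟩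
  · simp only [Sigma.mk.injEq] at hi
    obtain ⟨rfl, hi⟩ := hi
    simp only [heq_eq_eq, Prod.mk.injEq] at hi
    obtain ⟨rfl, rfl, rfl⟩ := hi
    refine le_of_eq_of_le ?_ (lexp_indicator_le (G.trans h s a b) E l)
    congr 1 with s'
    simp [devExp, count, countIn, countNext, transProb]
  · have hn : ∀ r s', ¬ ∃ r' s'', (⟨h, s, a, b, r, s'⟩ : G.Obs) = ⟨h₀, s₀, a₀, b₀, r', s''⟩ := by
      intro r s' hx
      exact hi ((G.exists_eq_iff_idx _ _ _ _ _).1 hx)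
    refine lexp_le_of_le fun s' _ => ?_
    have h0 : G.count [⟨h, s, a, b, G.reward h s a b, s'⟩] h₀ s₀ a₀ b₀ = 0 := by
      rw [count, List.countP_eq_zero]
      intro o ho
      rw [List.mem_singleton] at ho
      subst ho
      simpa using hn (G.reward h s a b) s'
    have h1 : G.countIn [⟨h, s, a, b, G.reward h s a b, s'⟩] h₀ s₀ a₀ b₀ E = 0 := by
      refine Finset.sum_eq_zero fun s'' _ => ?_
      rw [countNext, List.countP_eq_zero]
      intro o ho
      rw [List.mem_singleton] at ho
      subst ho
      simp only [decide_eq_true_eq]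
      rintro ⟨r, hr⟩
      exact hn _ _ ⟨r, s'', hr⟩
    simp [devExp, h0, h1]

theorem lexp_episodeLaw_devExp_le (μ : G.MaxPolicy) (ν : G.MinPolicy) (h : Fin (H + 1)) :
    ∀ s, lexp (G.episodeLaw μ ν h s)
      (fun τ => ENNReal.ofReal (Real.exp (G.devExp h₀ s₀ a₀ b₀ E l τ))) ≤ 1 := by
  induction h using Fin.reverseInduction with
  | last => intro s; simp [episodeLaw_last, lexp_pure, devExp_nil]
  | cast h ih =>
    intro s
    rw [lexp_episodeLaw_castSucc]
    refine lexp_le_of_le fun a _ => lexp_le_of_le fun b _ => ?_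
    refine le_trans (lexp_mono fun s' _ => ?_)
      (G.lexp_devExp_singleton_le h₀ s₀ a₀ b₀ E l h s a b)
    have hc : ∀ τ : List G.Obs, ENNReal.ofReal (Real.exp (G.devExp h₀ s₀ a₀ b₀ E l
        (⟨h, s, a, b, G.reward h s a b, s'⟩ :: τ))) =
        ENNReal.ofReal (Real.exp (G.devExp h₀ s₀ a₀ b₀ E l
          [⟨h, s, a, b, G.reward h s a b, s'⟩])) *
        ENNReal.ofReal (Real.exp (G.devExp h₀ s₀ a₀ b₀ E l τ)) := by
      intro τ
      rw [← List.singleton_append, devExp_append, Real.exp_add,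
        ENNReal.ofReal_mul (Real.exp_pos _).le]
    rw [funext hc, lexp_const_mul]
    exact mul_le_of_le_one_right' (ih s')

/-- The exponent is additive, and each episode contributes a factor of conditional mean at most `1`
whatever policies the past dictates. Adaptivity of the visits is thus harmless. -/
theorem lexp_ulcbRun_devExp_le (nash : G.MatrixSolver) (bonus : ℕ → ℝ) (s₁ : G.State 0) (K k : ℕ) :
    lexp (G.ulcbRun nash bonus s₁ K) (fun hist => ENNReal.ofReal (Real.exp
      (G.devExp h₀ s₀ a₀ b₀ E l (hist.take k).flatten))) ≤ 1 := by
  induction K with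
  | zero => simp [ulcbRun, lexp_pure, devExp_nil]
  | succ K ih =>
    rw [ulcbRun, lexp_bind]
    refine le_trans (lexp_mono fun hist _ => ?_) ih
    rw [lexp_map]
    simp only [List.take_append, List.flatten_append, devExp_append, Real.exp_add,
      ENNReal.ofReal_mul (Real.exp_pos _).le]
    rw [lexp_const_mul]
    refine mul_le_of_le_one_right' ?_
    -- The prefix of length `k` contains the new episode exactly when this difference is positive.
    cases k - hist.length with
    | zero => simp [devExp_nil, lexp_const]
    | succ n => simpa using G.lexp_episodeLaw_devExp_le h₀ s₀ a₀ b₀ E l _ _ 0 s₁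

/-- Hoeffding's inequality at a fixed number of visits. -/
theorem toOuterMeasure_deviation_le (nash : G.MatrixSolver) (bonus : ℕ → ℝ) (s₁ : G.State 0)
    (K k n : ℕ) {y : ℝ} (hy : 0 ≤ y) :
    (G.ulcbRun nash bonus s₁ K).toOuterMeasure {hist |
      G.count (hist.take k).flatten h₀ s₀ a₀ b₀ = n ∧ n ≠ 0 ∧
      n * G.transProb h₀ s₀ a₀ b₀ E + Real.sqrt (2 * y * n) <
        G.countIn (hist.take k).flatten h₀ s₀ a₀ b₀ E} ≤ ENNReal.ofReal (Real.exp (-y)) := by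
  -- This `l` is the optimal tilt `√(2y / n)` at `n` visits: a deviation beyond `√(2yn)` contributes
  -- at least `2y`, the quadratic correction is `y`, and the exponent is at least `y`.
  have hl := G.lexp_ulcbRun_devExp_le h₀ s₀ a₀ b₀ E (Real.sqrt (2 * y * n) / n) nash bonus s₁ K k
  refine le_trans (toOuterMeasure_le_lexp _ _ (fun hist => ENNReal.ofReal (Real.exp (-y)) *
    ENNReal.ofReal (Real.exp (G.devExp h₀ s₀ a₀ b₀ E (Real.sqrt (2 * y * n) / n)
      (hist.take k).flatten))) ?_) ?_
  · rintro hist ⟨h1, h2, h3⟩ -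
    rw [← ENNReal.ofReal_mul (Real.exp_pos _).le, ← Real.exp_add, ENNReal.one_le_ofReal,
      Real.one_le_exp_iff, devExp, h1]
    have hn : (0 : ℝ) < n := by positivity
    set r := Real.sqrt (2 * y * n) with hr
    have hr2 : r ^ 2 = 2 * y * n := Real.sq_sqrt (by positivity)
    have h4 : r / n * r ≤ r / n * (G.countIn (hist.take k).flatten h₀ s₀ a₀ b₀ E -
        n * G.transProb h₀ s₀ a₀ b₀ E) := by
      have : 0 ≤ r / n := by positivity
      gcongr
      linarith
    have h5 : r / n * r = 2 * y := by
      rw [div_mul_eq_mul_div, ← sq, hr2]; field_simp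
    have h6 : n * ((r / n) ^ 2 / 2) = y := by
      rw [div_pow, hr2]; field_simp
    linarith
  · rw [lexp_const_mul]
    exact mul_le_of_le_one_right' hl

end Concentration

/-- The empirical transition probabilities of all sets of states are close to the true ones. -/
def Concentrated (y : ℝ) (D : List G.Obs) : Prop :=
  ∀ (h : Fin H) (s : G.State h.castSucc) (a : G.ActMax h) (b : G.ActMin h)
    (E : Finset (G.State h.succ)), G.count D h s a b ≠ 0 →
      (G.countIn D h s a b E : ℝ) ≤ G.count D h s a b * G.transProb h s a b E +
        Real.sqrt (2 * y * G.count D h s a b)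

theorem mem_support_ulcbRun_succ {nash : G.MatrixSolver} {bonus : ℕ → ℝ} {s₁ : G.State 0} {K : ℕ}
    {hist : List (List G.Obs)} :
    hist ∈ (G.ulcbRun nash bonus s₁ (K + 1)).support ↔
      ∃ hist' ∈ (G.ulcbRun nash bonus s₁ K).support,
        ∃ τ ∈ (G.episodeLaw (G.ulcbMax nash bonus hist'.flatten)
          (G.ulcbMin nash bonus hist'.flatten) 0 s₁).support, hist' ++ [τ] = hist := by
  simp only [ulcbRun, PMF.mem_support_bind_iff, PMF.mem_support_map_iff]

theorem ulcbRun_support {nash : G.MatrixSolver} {bonus : ℕ → ℝ} {s₁ : G.State 0} {K : ℕ} :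
    ∀ hist ∈ (G.ulcbRun nash bonus s₁ K).support, hist.length = K ∧
      ∀ τ ∈ hist, G.RewardsValid τ ∧ τ.Pairwise (fun o o' => o.h ≠ o'.h) ∧ τ.length = H := by
  induction K with
  | zero =>
    intro hist hh
    rw [ulcbRun, PMF.mem_support_pure_iff] at hh
    subst hh
    simp
  | succ K ih =>
    intro hist hh
    rw [mem_support_ulcbRun_succ] at hh
    obtain ⟨hist', hh', τ, hτ, rfl⟩ := hh
    obtain ⟨h1, h2⟩ := ih hist' hh'
    obtain ⟨h3, -, h4, h5⟩ := G.episodeLaw_support _ _ 0 s₁ τ hτ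
    refine ⟨by simp [h1], fun τ' hτ' => ?_⟩
    rcases List.mem_append.1 hτ' with hτ' | hτ'
    · exact h2 τ' hτ'
    · rw [List.mem_singleton] at hτ'
      subst hτ'
      exact ⟨h3, h4, by simpa using h5⟩

theorem count_le_length (D : List G.Obs) (h : Fin H) (s : G.State h.castSucc)
    (a : G.ActMax h) (b : G.ActMin h) : G.count D h s a b ≤ D.length :=
  List.countP_le_length

theorem toOuterMeasure_not_concentrated_le (nash : G.MatrixSolver) (bonus : ℕ → ℝ)
    (s₁ : G.State 0) (K : ℕ) {y : ℝ} (hy : 0 ≤ y) {S A B : ℕ}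
    (hS : ∀ h, Fintype.card (G.State h) ≤ S) (hA : ∀ h, Fintype.card (G.ActMax h) ≤ A)
    (hB : ∀ h, Fintype.card (G.ActMin h) ≤ B) :
    (G.ulcbRun nash bonus s₁ K).toOuterMeasure
        {hist | ∃ k : Fin K, ¬ G.Concentrated y (hist.take k).flatten} ≤
      ENNReal.ofReal (K * (H * (S * (A * (B * ((2 ^ S : ℕ) * ((K * H + 1 : ℕ) *
        Real.exp (-y)))))))) := by
  refine toOuterMeasure_exists_le _ _ (fun k => ?_) (Fintype.card_fin K).le
  -- The visit count is random while the tilt needs a fixed `n`, hence a union over all its values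
  -- up to `KH`.
  refine le_trans (MeasureTheory.measure_mono (t := {hist | hist ∉ (G.ulcbRun nash bonus s₁
    K).support} ∪ {hist | ∃ (h : Fin H) (s : G.State h.castSucc) (a : G.ActMax h)
    (b : G.ActMin h) (E : Finset (G.State h.succ)) (n : Fin (K * H + 1)),
      G.count (hist.take k).flatten h s a b = n ∧ (n : ℕ) ≠ 0 ∧
        (n : ℕ) * G.transProb h s a b E + Real.sqrt (2 * y * (n : ℕ)) <
        G.countIn (hist.take k).flatten h s a b E}) ?_) ?_
  · intro hist hh
    by_cases hs : hist ∈ (G.ulcbRun nash bonus s₁ K).support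
    · right
      simp only [Concentrated, not_forall, not_le, Set.mem_ofPred_eq] at hh
      obtain ⟨h, s, a, b, E, h1, h2⟩ := hh
      obtain ⟨h3, h4⟩ := G.ulcbRun_support hist hs
      refine ⟨h, s, a, b, E, ⟨G.count (hist.take k).flatten h s a b, ?_⟩, rfl, h1, h2⟩
      refine Nat.lt_succ_of_le ((G.count_le_length _ h s a b).trans ?_)
      rw [List.length_flatten]
      refine (List.sum_le_card_nsmul _ H ?_).trans ?_
      · intro m hm
        obtain ⟨τ, hτ, rfl⟩ := List.mem_map.1 hm
        exact (h4 τ (List.mem_of_mem_take hτ)).2.2.le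
      · rw [List.length_map, smul_eq_mul]
        gcongr
        exact (List.length_take_le' _ _).trans h3.le
    · exact Or.inl hs
  · refine (MeasureTheory.measure_union_le _ _).trans ?_
    have h0 : (G.ulcbRun nash bonus s₁ K).toOuterMeasure
        {hist | hist ∉ (G.ulcbRun nash bonus s₁ K).support} = 0 := by
      rw [PMF.toOuterMeasure_apply_eq_zero_iff, Set.disjoint_left]
      exact fun x hx hx' => hx' hx
    rw [h0, zero_add]
    refine toOuterMeasure_exists_le _ _ (fun h => ?_) (Fintype.card_fin H).le
    refine toOuterMeasure_exists_le _ _ (fun s => ?_) (hS _)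
    refine toOuterMeasure_exists_le _ _ (fun a => ?_) (hA h)
    refine toOuterMeasure_exists_le _ _ (fun b => ?_) (hB h)
    refine toOuterMeasure_exists_le _ _ (fun E => ?_) ?_
    · refine toOuterMeasure_exists_le _ _ (fun n => ?_) (Fintype.card_fin _).le
      exact G.toOuterMeasure_deviation_le h s a b E nash bonus s₁ K k n hy
    · rw [Fintype.card_finset]
      exact Nat.pow_le_pow_right (by norm_num) (hS _)

/-! ### Chernoff bound for sums of conditional expectations. -/

/-- The expectation of `X` over the next episode of VI-ULCB with the data `D`. -/
noncomputable def nextExpect (nash : G.MatrixSolver) (bonus : ℕ → ℝ) (s₁ : G.State 0)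
    (X : List G.Obs → List G.Obs → ℝ) (D : List G.Obs) : ℝ :=
  expect (G.episodeLaw (G.ulcbMax nash bonus D) (G.ulcbMin nash bonus D) 0 s₁) (X D)

theorem lexp_ulcbRun_chernoff_le (nash : G.MatrixSolver) (bonus : ℕ → ℝ) (s₁ : G.State 0)
    (X : List G.Obs → List G.Obs → ℝ)
    (hX : ∀ D τ, τ.length = H → X D τ ∈ Set.Icc (0 : ℝ) 1) (K : ℕ) :
    lexp (G.ulcbRun nash bonus s₁ K) (fun hist => ENNReal.ofReal (Real.exp
      (∑ k ∈ Finset.range K, (G.nextExpect nash bonus s₁ X (hist.take k).flatten / 2 -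
        X (hist.take k).flatten (hist.getD k []))))) ≤ 1 := by
  induction K with
  | zero => simp [ulcbRun, lexp_pure]
  | succ K ih =>
    rw [ulcbRun, lexp_bind]
    refine le_trans (lexp_mono fun hist hh => ?_) ih
    rw [lexp_map]
    have hlen : hist.length = K := (G.ulcbRun_support hist hh).1
    have hc : ∀ τ : List G.Obs,
        ∑ k ∈ Finset.range (K + 1),
          (G.nextExpect nash bonus s₁ X ((hist ++ [τ]).take k).flatten / 2 -
          X ((hist ++ [τ]).take k).flatten ((hist ++ [τ]).getD k [])) =
        (∑ k ∈ Finset.range K, (G.nextExpect nash bonus s₁ X (hist.take k).flatten / 2 -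
          X (hist.take k).flatten (hist.getD k [])) +
          G.nextExpect nash bonus s₁ X hist.flatten / 2) + -X hist.flatten τ := by
      intro τ
      rw [Finset.sum_range_succ]
      have h1 : (hist ++ [τ]).take K = hist := by rw [← hlen]; simp
      have h2 : (hist ++ [τ]).getD K [] = τ := by rw [← hlen]; simp
      rw [h1, h2, sub_eq_add_neg, add_assoc]
      congr 1
      refine Finset.sum_congr rfl fun k hk => ?_
      have hk' : k < hist.length := hlen ▸ Finset.mem_range.1 hk
      rw [List.take_append_of_le_length hk'.le, List.getD_append _ _ _ _ hk']
    simp only [hc, Real.exp_add _ (-X _ _), ENNReal.ofReal_mul (Real.exp_pos _).le]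
    rw [lexp_const_mul, Real.exp_add, ENNReal.ofReal_mul (Real.exp_pos _).le, mul_assoc]
    refine mul_le_of_le_one_right' ?_
    have h3 := lexp_exp_neg_le (G.episodeLaw_support_finite (G.ulcbMax nash bonus hist.flatten)
      (G.ulcbMin nash bonus hist.flatten) 0 s₁) (f := X hist.flatten) fun τ hτ =>
        hX _ _ (by simpa using (G.episodeLaw_support _ _ 0 s₁ τ hτ).2.2.2)
    refine (mul_le_mul_right h3 _).trans ?_
    rw [← ENNReal.ofReal_mul (Real.exp_pos _).le, ← Real.exp_add, nextExpect, add_neg_cancel,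
      Real.exp_zero, ENNReal.ofReal_one]

/-- For variables in `[0, 1]` the multiplicative form loses a factor `2` and an additive `2y`, but
no term of order `√K`. -/
theorem toOuterMeasure_chernoff_le (nash : G.MatrixSolver) (bonus : ℕ → ℝ) (s₁ : G.State 0)
    (X : List G.Obs → List G.Obs → ℝ)
    (hX : ∀ D τ, τ.length = H → X D τ ∈ Set.Icc (0 : ℝ) 1) (K : ℕ) (y : ℝ) :
    (G.ulcbRun nash bonus s₁ K).toOuterMeasure {hist |
      2 * ∑ k ∈ Finset.range K, X (hist.take k).flatten (hist.getD k []) + 2 * y <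
        ∑ k ∈ Finset.range K, G.nextExpect nash bonus s₁ X (hist.take k).flatten} ≤
      ENNReal.ofReal (Real.exp (-y)) := by
  refine le_trans (toOuterMeasure_le_lexp _ _ (fun hist => ENNReal.ofReal (Real.exp (-y)) *
    ENNReal.ofReal (Real.exp (∑ k ∈ Finset.range K, (G.nextExpect nash bonus s₁ X
      (hist.take k).flatten / 2 - X (hist.take k).flatten (hist.getD k []))))) ?_) ?_
  · intro hist hh _
    rw [← ENNReal.ofReal_mul (Real.exp_pos _).le, ← Real.exp_add, ENNReal.one_le_ofReal,
      Real.one_le_exp_iff, Finset.sum_sub_distrib, ← Finset.sum_div]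
    simp only [Set.mem_ofPred_eq] at hh
    linarith
  · rw [lexp_const_mul]
    exact mul_le_of_le_one_right' (G.lexp_ulcbRun_chernoff_le nash bonus s₁ X hX K)

/-! ### Optimism of the estimates and the bound on the duality gap. -/

section Optimism

variable {G} {nash : G.MatrixSolver} {bonus : ℕ → ℝ} {D : List G.Obs}

theorem sum_freq_eq_one {h : Fin H} {s : G.State h.castSucc} {a : G.ActMax h} {b : G.ActMin h}
    (hc : G.count D h s a b ≠ 0) :
    ∑ s', (G.countNext D h s a b s' : ℝ) / (G.count D h s a b : ℝ) = 1 := by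
  rw [← Finset.sum_div, ← Nat.cast_sum]
  have := G.countIn_univ D h s a b
  rw [countIn] at this
  rw [this, div_self]
  exact_mod_cast hc

theorem transEst_mono {h : Fin H} {s : G.State h.castSucc} {a : G.ActMax h} {b : G.ActMin h}
    {V W : G.State h.succ → ℝ} (hVW : ∀ s', V s' ≤ W s') :
    G.transEst D h V s a b ≤ G.transEst D h W s a b :=
  Finset.sum_le_sum fun s' _ => mul_le_mul_of_nonneg_left (hVW s') (by positivity)

theorem transEst_const {h : Fin H} {s : G.State h.castSucc} {a : G.ActMax h} {b : G.ActMin h}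
    (hc : G.count D h s a b ≠ 0) (x : ℝ) : G.transEst D h (fun _ => x) s a b = x := by
  rw [transEst, ← Finset.sum_mul, sum_freq_eq_one hc, one_mul]

theorem transEst_sub {h : Fin H} {s : G.State h.castSucc} {a : G.ActMax h} {b : G.ActMin h}
    (V W : G.State h.succ → ℝ) : G.transEst D h (fun s' => V s' - W s') s a b =
      G.transEst D h V s a b - G.transEst D h W s a b := by
  simp only [transEst, mul_sub, Finset.sum_sub_distrib]

/-- `[P_h V](s, a, b)` for the true transition probabilities. -/
noncomputable def transMean (h : Fin H) (V : G.State h.succ → ℝ)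
    (s : G.State h.castSucc) (a : G.ActMax h) (b : G.ActMin h) : ℝ :=
  ∑ s', (G.trans h s a b s').toReal * V s'

theorem transMean_mono {h : Fin H} {s : G.State h.castSucc} {a : G.ActMax h} {b : G.ActMin h}
    {V W : G.State h.succ → ℝ} (hVW : ∀ s', V s' ≤ W s') :
    transMean h V s a b ≤ transMean h W s a b :=
  Finset.sum_le_sum fun s' _ => mul_le_mul_of_nonneg_left (hVW s') ENNReal.toReal_nonneg

theorem transMean_const {h : Fin H} {s : G.State h.castSucc} {a : G.ActMax h} {b : G.ActMin h}
    (x : ℝ) : transMean h (fun _ => x) s a b = x := by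
  rw [transMean, ← Finset.sum_mul, sum_toReal_eq_one, one_mul]

theorem transMean_sub {h : Fin H} {s : G.State h.castSucc} {a : G.ActMax h} {b : G.ActMin h}
    (V W : G.State h.succ → ℝ) : transMean h (fun s' => V s' - W s') s a b =
      transMean h V s a b - transMean h W s a b := by
  simp only [transMean, mul_sub, Finset.sum_sub_distrib]

variable {y : ℝ} (hD : G.Concentrated y D)
  (hb : ∀ n : ℕ, n ≠ 0 → H * Real.sqrt (2 * y * n) ≤ n * bonus n)

include hD hb

theorem transEst_le {h : Fin H} {s : G.State h.castSucc} {a : G.ActMax h} {b : G.ActMin h}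
    (hc : G.count D h s a b ≠ 0) {V : G.State h.succ → ℝ} (hV : ∀ s', V s' ∈ Set.Icc (0 : ℝ) H) :
    G.transEst D h V s a b ≤ transMean h V s a b + bonus (G.count D h s a b) := by
  classical
  set n := G.count D h s a b with hn
  have hn0 : (0 : ℝ) < n := by exact_mod_cast Nat.pos_of_ne_zero hc
  -- The over-represented states carry all positive terms, and `V ≤ H` bounds them by `H` times the
  -- deviation of the single set `E`. As `E` depends on the data, all subsets are needed in
  -- `Concentrated`.
  set E : Finset (G.State h.succ) := Finset.univ.filter fun s' =>
    n * (G.trans h s a b s').toReal ≤ G.countNext D h s a b s' with hE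
  have h1 : n * (G.transEst D h V s a b - transMean h V s a b) =
      ∑ s', ((G.countNext D h s a b s' : ℝ) - n * (G.trans h s a b s').toReal) * V s' := by
    rw [transEst, transMean, ← Finset.sum_sub_distrib, Finset.mul_sum]
    refine Finset.sum_congr rfl fun s' _ => ?_
    rw [← hn]
    field_simp
  have h2 : ∑ s', ((G.countNext D h s a b s' : ℝ) - n * (G.trans h s a b s').toReal) * V s' ≤
      ∑ s' ∈ E, ((G.countNext D h s a b s' : ℝ) - n * (G.trans h s a b s').toReal) * H := by
    rw [hE, Finset.sum_filter]
    refine Finset.sum_le_sum fun s' _ => ?_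
    split_ifs with hs
    · exact mul_le_mul_of_nonneg_left (hV s').2 (sub_nonneg.2 hs)
    · exact mul_nonpos_of_nonpos_of_nonneg (sub_nonpos.2 (not_le.1 hs).le) (hV s').1
  have h3 := hD h s a b E hc
  have h4 : ∑ s' ∈ E, ((G.countNext D h s a b s' : ℝ) - n * (G.trans h s a b s').toReal) * H =
      H * (G.countIn D h s a b E - n * G.transProb h s a b E) := by
    rw [← Finset.sum_mul, Finset.sum_sub_distrib, ← Finset.mul_sum, countIn, transProb,
      Nat.cast_sum, mul_comm]
  have h5 : H * ((G.countIn D h s a b E : ℝ) - n * G.transProb h s a b E) ≤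
      H * Real.sqrt (2 * y * n) := by
    gcongr
    linarith
  have h6 := hb n hc
  have h7 : n * (G.transEst D h V s a b - transMean h V s a b) ≤ n * bonus n := by linarith
  have := le_of_mul_le_mul_left h7 hn0
  linarith

theorem le_transEst {h : Fin H} {s : G.State h.castSucc} {a : G.ActMax h} {b : G.ActMin h}
    (hc : G.count D h s a b ≠ 0) {V : G.State h.succ → ℝ} (hV : ∀ s', V s' ∈ Set.Icc (0 : ℝ) H) :
    transMean h V s a b - bonus (G.count D h s a b) ≤ G.transEst D h V s a b := by
  -- Reflecting `V` to `H - V` turns the one-sided bound into the opposite one.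
  have := transEst_le hD hb hc (V := fun s' => H - V s') fun s' =>
    ⟨sub_nonneg.2 (hV s').2, sub_le_self _ (hV s').1⟩
  rw [transEst_sub, transMean_sub, transEst_const hc, transMean_const] at this
  linarith

omit hD hb

variable (nash bonus D) in
theorem vUpLow_last (s : G.State (Fin.last H)) :
    G.vUpLow nash bonus D (Fin.last H) s = (0, 0) := by
  simp [vUpLow]

variable (nash bonus D) in
theorem vUpLow_castSucc (h : Fin H) (s : G.State h.castSucc) :
    G.vUpLow nash bonus D h.castSucc s =
      (payoff (G.qUp bonus D h (fun s' => (G.vUpLow nash bonus D h.succ s').1) s)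
        (G.ulcbMax nash bonus D h s) (G.ulcbMin nash bonus D h s),
      payoff (G.qLow bonus D h (fun s' => (G.vUpLow nash bonus D h.succ s').2) s)
        (G.ulcbMax nash bonus D h s) (G.ulcbMin nash bonus D h s)) := by
  simp [vUpLow, ulcbMax, ulcbMin, ulcbActions]

variable (hr : G.RewardsValid D) (hb0 : ∀ n, 0 ≤ bonus n)

include hr in
theorem rewardEst_mem {h : Fin H} {s : G.State h.castSucc} {a : G.ActMax h} {b : G.ActMin h}
    (hc : G.count D h s a b ≠ 0) : G.rewardEst D h s a b ∈ Set.Icc (0 : ℝ) 1 := by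
  rw [hr.rewardEst_eq hc]
  exact G.reward_mem h s a b

include hr hb0 in
-- Puts both estimates in the range `[0, H]` required by `transEst_le`. The lower estimate is not
-- truncated from above, so its bound must be the inductive `H - h`: it grows by at most one reward
-- per step.
theorem vUpLow_mem (h : Fin (H + 1)) : ∀ s,
    (G.vUpLow nash bonus D h s).1 ∈ Set.Icc (0 : ℝ) H ∧
      (G.vUpLow nash bonus D h s).2 ∈ Set.Icc (0 : ℝ) (H - h) := by
  induction h using Fin.reverseInduction with
  | last => intro s; rw [vUpLow_last]; simp
  | cast h ih =>
    intro s
    rw [vUpLow_castSucc]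
    set φ := G.ulcbMax nash bonus D h s
    set ψ := G.ulcbMin nash bonus D h s
    have hh : (h : ℝ) + 1 ≤ H := by exact_mod_cast h.2
    refine ⟨⟨?_, ?_⟩, ⟨?_, ?_⟩⟩
    · rw [← payoff_const φ ψ 0]
      refine payoff_mono _ _ fun a b => ?_
      rw [qUp]
      split_ifs with hc
      · positivity
      · refine le_min (add_nonneg (add_nonneg (rewardEst_mem hr hc).1 ?_) (hb0 _)) (by positivity)
        rw [← transEst_const hc 0]
        exact transEst_mono fun s' => (ih s').1.1
    · rw [← payoff_const φ ψ (H : ℝ)]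
      refine payoff_mono _ _ fun a b => ?_
      rw [qUp]
      split_ifs with hc
      · exact le_rfl
      · exact min_le_right _ _
    · rw [← payoff_const φ ψ 0]
      refine payoff_mono _ _ fun a b => ?_
      rw [qLow]
      split_ifs with hc
      · exact le_rfl
      · exact le_max_right _ _
    · rw [← payoff_const φ ψ ((H : ℝ) - h.castSucc)]
      refine payoff_mono _ _ fun a b => ?_
      rw [qLow]
      simp only [Fin.val_castSucc]
      split_ifs with hc
      · linarith
      · refine max_le ?_ (by linarith)
        have h1 : G.transEst D h (fun s' => (G.vUpLow nash bonus D h.succ s').2) s a b ≤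
            H - (h + 1) := by
          rw [← transEst_const hc ((H : ℝ) - (h + 1))]
          refine transEst_mono fun s' => ?_
          have := (ih s').2.2
          simpa using this
        have h2 := (rewardEst_mem hr hc).2
        have h3 := hb0 (G.count D h s a b)
        linarith

include hD hb hr hb0 in
-- Against the fixed column strategy, deviating to `μ` cannot raise the row player's payoff in the
-- matrix `Q^up`, and `Q^up` dominates the true action values by induction. The cap at `H` is
-- harmless, since these never exceed `H`.
theorem value_le_vUp (hnash : nash.IsNash) (μ : G.MaxPolicy) (h : Fin (H + 1)) : ∀ s,
    G.value μ (G.ulcbMin nash bonus D) h s ≤ (G.vUpLow nash bonus D h s).1 := by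
  induction h using Fin.reverseInduction with
  | last => intro s; rw [vUpLow_last, value_eq_expectSum, expectSum_last]
  | cast h ih =>
    intro s
    rw [vUpLow_castSucc, value_castSucc]
    refine le_trans (payoff_mono _ _ fun a b => ?_) ((hnash h _ _).1 (μ h s))
    have hm : transMean h (fun s' => G.value μ (G.ulcbMin nash bonus D) h.succ s') s a b ≤ H - 1 := by
      rw [← transMean_const (h := h) (s := s) (a := a) (b := b) ((H : ℝ) - 1)]
      refine transMean_mono fun s' => ((G.value_mem _ _ _ s').2.trans ?_)
      simp
    have hrw := (G.reward_mem h s a b).2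
    change G.reward h s a b +
      transMean h (fun s' => G.value μ (G.ulcbMin nash bonus D) h.succ s') s a b ≤ _
    rw [qUp]
    split_ifs with hc
    · linarith
    · refine le_min ?_ (by linarith)
      rw [hr.rewardEst_eq hc]
      have h1 := le_transEst hD hb hc fun s' => (vUpLow_mem (nash := nash) hr hb0 h.succ s').1
      have h2 := transMean_mono (h := h) (s := s) (a := a) (b := b) ih
      linarith

include hD hb hr hb0 in
theorem vLow_le_value (hnash : nash.IsNash) (ν : G.MinPolicy) (h : Fin (H + 1)) : ∀ s,
    (G.vUpLow nash bonus D h s).2 ≤ G.value (G.ulcbMax nash bonus D) ν h s := by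
  induction h using Fin.reverseInduction with
  | last => intro s; rw [vUpLow_last, value_eq_expectSum, expectSum_last]
  | cast h ih =>
    intro s
    rw [vUpLow_castSucc, value_castSucc]
    refine le_trans ((hnash h _ _).2 (ν h s)) (payoff_mono _ _ fun a b => ?_)
    have hm : 0 ≤ transMean h (fun s' => G.value (G.ulcbMax nash bonus D) ν h.succ s') s a b := by
      rw [← transMean_const (h := h) (s := s) (a := a) (b := b) 0]
      exact transMean_mono fun s' => (G.value_mem _ _ _ s').1
    have hrw := (G.reward_mem h s a b).1
    change _ ≤ G.reward h s a b +
      transMean h (fun s' => G.value (G.ulcbMax nash bonus D) ν h.succ s') s a b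
    rw [qLow]
    split_ifs with hc
    · linarith
    · refine max_le ?_ (by linarith)
      rw [hr.rewardEst_eq hc]
      have h1 := transEst_le hD hb hc fun s' =>
        Set.Icc_subset_Icc_right (sub_le_self _ (by positivity))
          (vUpLow_mem (nash := nash) hr hb0 h.succ s').2
      have h2 := transMean_mono (h := h) (s := s) (a := a) (b := b) ih
      linarith

variable (H bonus) in
/-- The width of the confidence interval after `n` visits. -/
noncomputable def width (n : ℕ) : ℝ := if n = 0 then (H : ℝ) else min H (4 * bonus n)

include hb0 in
theorem width_mem (n : ℕ) : width H bonus n ∈ Set.Icc (0 : ℝ) H := by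
  rw [width]
  split_ifs
  · exact ⟨by positivity, le_rfl⟩
  · exact ⟨le_min (by positivity) (mul_nonneg (by norm_num) (hb0 n)), min_le_left _ _⟩

variable (bonus D) in
/-- The width of the confidence interval at an observation. -/
noncomputable def obsWidth (o : G.Obs) : ℝ := width H bonus (G.count D o.h o.s o.a o.b)

include hD hb hr hb0 in
theorem vUp_sub_vLow_le (h : Fin (H + 1)) : ∀ s,
    (G.vUpLow nash bonus D h s).1 - (G.vUpLow nash bonus D h s).2 ≤
      G.expectSum (G.ulcbMax nash bonus D) (G.ulcbMin nash bonus D) (obsWidth bonus D) h s := by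
  have hnonneg : ∀ (μ : G.MaxPolicy) (ν : G.MinPolicy) (h : Fin (H + 1)) (s : G.State h),
      0 ≤ G.expectSum μ ν (obsWidth bonus D) h s := by
    intro μ ν h s
    rw [expectSum, ← expect_const (G.episodeLaw μ ν h s) 0]
    refine expect_mono (G.episodeLaw_support_finite μ ν h s) fun τ _ => List.sum_nonneg ?_
    intro x hx
    obtain ⟨o, -, rfl⟩ := List.mem_map.1 hx
    exact (width_mem hb0 _).1
  induction h using Fin.reverseInduction with
  | last => intro s; rw [vUpLow_last, expectSum_last]; simp
  | cast h ih =>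
    intro s
    rw [vUpLow_castSucc, ← payoff_sub, expectSum_castSucc]
    refine payoff_mono _ _ fun a b => ?_
    simp only [obsWidth, mul_add, Finset.sum_add_distrib, ← Finset.sum_mul, sum_toReal_eq_one,
      one_mul]
    change _ ≤ _ + transMean h (fun s' => G.expectSum (G.ulcbMax nash bonus D)
      (G.ulcbMin nash bonus D) (obsWidth bonus D) h.succ s') s a b
    have h0 : 0 ≤ transMean h (fun s' => G.expectSum (G.ulcbMax nash bonus D)
        (G.ulcbMin nash bonus D) (obsWidth bonus D) h.succ s') s a b := by
      rw [← transMean_const (h := h) (s := s) (a := a) (b := b) 0]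
      exact transMean_mono fun s' => hnonneg _ _ _ s'
    rw [qUp, qLow, width]
    split_ifs with hc
    · linarith
    · have h1 := transEst_le hD hb hc fun s' => (vUpLow_mem (nash := nash) hr hb0 h.succ s').1
      have h2 := le_transEst hD hb hc fun s' =>
        Set.Icc_subset_Icc_right (sub_le_self _ (by positivity))
          (vUpLow_mem (nash := nash) hr hb0 h.succ s').2
      have h3 := transMean_mono (h := h) (s := s) (a := a) (b := b) ih
      rw [transMean_sub] at h3
      -- The bound `H` comes from truncation, the remaining term being nonnegative. In `4 * bonus`,
      -- two bonuses come from `Q^up` and `Q^low` themselves and two from replacing `P̂` by `P` in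
      -- each.
      rw [← min_add_add_right]
      refine le_min ?_ ?_
      · have := min_le_right (G.rewardEst D h s a b + G.transEst D h
          (fun s' => (G.vUpLow nash bonus D h.succ s').1) s a b + bonus (G.count D h s a b)) (H : ℝ)
        have := le_max_right (G.rewardEst D h s a b + G.transEst D h
          (fun s' => (G.vUpLow nash bonus D h.succ s').2) s a b - bonus (G.count D h s a b)) 0
        linarith
      · have := min_le_left (G.rewardEst D h s a b + G.transEst D h
          (fun s' => (G.vUpLow nash bonus D h.succ s').1) s a b + bonus (G.count D h s a b)) (H : ℝ)
        have := le_max_left (G.rewardEst D h s a b + G.transEst D h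
          (fun s' => (G.vUpLow nash bonus D h.succ s').2) s a b - bonus (G.count D h s a b)) 0
        linarith

include hD hb hr hb0 in
theorem duality_gap_le (hnash : nash.IsNash) (s : G.State 0) :
    G.valueMaxBest (G.ulcbMin nash bonus D) s - G.valueMinBest (G.ulcbMax nash bonus D) s ≤
      G.expectSum (G.ulcbMax nash bonus D) (G.ulcbMin nash bonus D) (obsWidth bonus D) 0 s := by
  have : Nonempty G.MaxPolicy := ⟨G.ulcbMax nash bonus D⟩
  have : Nonempty G.MinPolicy := ⟨G.ulcbMin nash bonus D⟩
  have h1 : G.valueMaxBest (G.ulcbMin nash bonus D) s ≤ (G.vUpLow nash bonus D 0 s).1 :=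
    ciSup_le fun μ => value_le_vUp hD hb hr hb0 hnash μ 0 s
  have h2 : (G.vUpLow nash bonus D 0 s).2 ≤ G.valueMinBest (G.ulcbMax nash bonus D) s :=
    le_ciInf fun ν => vLow_le_value hD hb hr hb0 hnash ν 0 s
  linarith [vUp_sub_vLow_le (nash := nash) hD hb hr hb0 0 s]

end Optimism

/-! ### Pigeonhole bound for the realized widths. -/

section Pigeonhole

/-- The number of visits to a state-action triple. -/
noncomputable def visits (D : List G.Obs) (i : G.Idx) : ℕ := G.count D i.1 i.2.1 i.2.2.1 i.2.2.2

open Classical in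
theorem visits_eq (D : List G.Obs) (i : G.Idx) : G.visits D i = (D.map Obs.idx).count i :=
  G.count_eq D i.1 i.2.1 i.2.2.1 i.2.2.2

theorem sum_visits (D : List G.Obs) : ∑ i, G.visits D i = D.length := by
  classical
  have := Multiset.sum_count_eq_card (s := Finset.univ) (m := ((D.map Obs.idx : List G.Idx) :
    Multiset G.Idx)) fun _ _ => Finset.mem_univ _
  simpa [visits_eq] using this

theorem visits_append (D D' : List G.Obs) (i : G.Idx) :
    G.visits (D ++ D') i = G.visits D i + G.visits D' i :=
  G.count_append D D' _ _ _ _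

theorem card_idx_le {S A B : ℕ} (hS : ∀ h, Fintype.card (G.State h) ≤ S)
    (hA : ∀ h, Fintype.card (G.ActMax h) ≤ A) (hB : ∀ h, Fintype.card (G.ActMin h) ≤ B) :
    Fintype.card G.Idx ≤ H * (S * (A * B)) := by
  rw [Fintype.card_sigma]
  refine (Finset.sum_le_card_nsmul _ _ (S * (A * B)) fun h _ => ?_).trans (by simp)
  rw [Fintype.card_prod, Fintype.card_prod]
  exact Nat.mul_le_mul (hS _) (Nat.mul_le_mul (hA h) (hB h))

variable (bonus : ℕ → ℝ)

/-- The sum of the widths of the confidence intervals at the first `n` visits. -/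
noncomputable def cumWidth (H : ℕ) (n : ℕ) : ℝ := ∑ t ∈ Finset.range n, width H bonus t

variable {G} in
-- The counts are frozen during an episode, but each triple belongs to one step and so occurs at
-- most once. Hence each width is exactly the next term of `cumWidth`, and summing over episodes
-- telescopes.
theorem sum_obsWidth_episode (D : List G.Obs) {τ : List G.Obs}
    (hτ : τ.Pairwise fun o o' => o.h ≠ o'.h) :
    (τ.map (obsWidth bonus D)).sum =
      ∑ i, (cumWidth bonus H (G.visits (D ++ τ) i) - cumWidth bonus H (G.visits D i)) := by
  classical
  have hnd : (τ.map Obs.idx).Nodup := by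
    rw [List.Nodup, List.pairwise_map]
    exact hτ.imp fun hne he => hne (congrArg Sigma.fst he)
  have h1 : τ.map (obsWidth bonus D) =
      (τ.map Obs.idx).map fun i => width H bonus (G.visits D i) := by
    rw [List.map_map]
    rfl
  rw [h1, ← List.sum_toFinset _ hnd, ← Finset.sum_subset (Finset.subset_univ _)]
  · refine Finset.sum_congr rfl fun i hi => ?_
    rw [List.mem_toFinset] at hi
    rw [visits_append, visits_eq G τ, List.count_eq_one_of_mem hnd hi, cumWidth, cumWidth,
      Finset.sum_range_succ, add_sub_cancel_left]
  · intro i _ hi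
    rw [List.mem_toFinset] at hi
    rw [visits_append, visits_eq G τ, List.count_eq_zero_of_not_mem hi, add_zero, sub_self]

variable {G bonus} in
theorem sum_obsWidth_run {K : ℕ} {hist : List (List G.Obs)} (hl : hist.length = K)
    (hp : ∀ τ ∈ hist, τ.Pairwise fun o o' => o.h ≠ o'.h) :
    ∑ k ∈ Finset.range K,
        ((hist.getD k []).map (obsWidth bonus (hist.take k).flatten)).sum =
      ∑ i, cumWidth bonus H (G.visits hist.flatten i) := by
  have h1 : ∀ k ∈ Finset.range K,
      ((hist.getD k []).map (obsWidth bonus (hist.take k).flatten)).sum =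
      ∑ i, cumWidth bonus H (G.visits (hist.take (k + 1)).flatten i) -
        ∑ i, cumWidth bonus H (G.visits (hist.take k).flatten i) := by
    intro k hk
    have hk' : k < hist.length := hl ▸ Finset.mem_range.1 hk
    rw [List.getD_eq_getElem _ _ hk', sum_obsWidth_episode bonus _ (hp _ (List.getElem_mem hk')),
      Finset.sum_sub_distrib]
    congr 3
    ext i
    rw [List.take_succ_eq_append_getElem hk', List.flatten_append, List.flatten_singleton]
  rw [Finset.sum_congr rfl h1, Finset.sum_range_sub fun k =>
    ∑ i, cumWidth bonus H (G.visits (hist.take k).flatten i), ← hl, List.take_length]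
  simp [visits, count, cumWidth]

theorem one_div_sqrt_succ_le (n : ℕ) :
    1 / Real.sqrt (n + 1) ≤ 2 * (Real.sqrt (n + 1) - Real.sqrt n) := by
  have h0 : 0 < Real.sqrt (n + 1) := Real.sqrt_pos.2 (by positivity)
  have h1 : Real.sqrt (n + 1) ^ 2 = n + 1 := Real.sq_sqrt (by positivity)
  have h2 : Real.sqrt n ^ 2 = n := Real.sq_sqrt (by positivity)
  rw [div_le_iff₀ h0]
  nlinarith [sq_nonneg (Real.sqrt (n + 1) - Real.sqrt n)]

variable {bonus} {w : ℝ} (hw : 0 ≤ w) (hbw : ∀ n : ℕ, bonus (n + 1) ≤ w / Real.sqrt (n + 1))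

include hw hbw

/-- The first visit is made at count `0` and costs `H`; the `n` others cost at most `4w / √t`, and
`∑ 1 / √t ≤ 2 √n`. -/
theorem cumWidth_succ_le (n : ℕ) : cumWidth bonus H (n + 1) ≤ H + 8 * w * Real.sqrt n := by
  induction n with
  | zero => simp [cumWidth, width]
  | succ n ih =>
    rw [cumWidth, Finset.sum_range_succ, ← cumWidth]
    have h1 : width H bonus (n + 1) ≤ 4 * (w / Real.sqrt (n + 1)) := by
      rw [width, if_neg (Nat.succ_ne_zero n)]
      refine (min_le_right _ _).trans ?_
      linarith [hbw n]
    have h2 := mul_le_mul_of_nonneg_left (one_div_sqrt_succ_le n) (show 0 ≤ 4 * w by positivity)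
    rw [mul_one_div, mul_div_assoc] at h2
    push_cast
    linarith

theorem cumWidth_le (n : ℕ) : cumWidth bonus H n ≤ H + 8 * w * Real.sqrt n := by
  cases n with
  | zero => simp [cumWidth]
  | succ n =>
    refine (cumWidth_succ_le hw hbw n).trans ?_
    gcongr
    simp

variable {G} in
theorem sum_cumWidth_le (D : List G.Obs) {m : ℝ} (hm : Fintype.card G.Idx ≤ m) :
    ∑ i, cumWidth bonus H (G.visits D i) ≤ m * H + 8 * w * Real.sqrt (m * D.length) := by
  refine (Finset.sum_le_sum fun i _ => cumWidth_le hw hbw (G.visits D i)).trans ?_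
  rw [Finset.sum_add_distrib, ← Finset.mul_sum, Finset.sum_const, Finset.card_univ, nsmul_eq_mul]
  -- Cauchy–Schwarz, with the visits of all triples adding up to the length of the data.
  have h1 : ∑ i, Real.sqrt (G.visits D i) ≤ Real.sqrt (m * D.length) := by
    refine Real.le_sqrt_of_sq_le ?_
    refine (sq_sum_le_card_mul_sum_sq (s := Finset.univ)).trans ?_
    simp only [Real.sq_sqrt (Nat.cast_nonneg _), ← Nat.cast_sum, G.sum_visits, Finset.card_univ]
    gcongr
  gcongr

end Pigeonhole

end MarkovGame

/-! ### Inversion of the sample-size condition. -/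

/-- Solving `b (log Z + log K) ≤ K` for `K`: the logarithm of `K` can be absorbed. -/
theorem mul_log_le_of_le {M : ℝ} (hM : 1 ≤ M) {H S A B K : ℕ} (hK : 1 ≤ K)
    (hZ : 2 ≤ H * S * A * B) {p ε : ℝ} (hp : 0 < p) (hp1 : p < 1) (hε : 0 < ε)
    (h : 4 * M ^ 2 * (4 + 2 * Real.log (4 * M ^ 2)) * ((H : ℝ) ^ 4 * (S : ℝ) ^ 2 * A * B *
      Real.log ((H : ℝ) * S * A * B / (p * min ε 1)) / ε ^ 2) ≤ K) :
    M ^ 2 * ((H : ℝ) ^ 4 * (S : ℝ) ^ 2 * A * B * Real.log ((S : ℝ) * A * B * (K * H) / p)) ≤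
      ε ^ 2 * K := by
  set Z : ℝ := (H : ℝ) * S * A * B with hZdef
  have hZ2 : (2 : ℝ) ≤ Z := by rw [hZdef]; exact_mod_cast hZ
  have hpos : 0 < H * S * A * B := by omega
  have hH : 1 ≤ (H : ℝ) := by
    exact_mod_cast Nat.pos_of_ne_zero fun h0 => by simp [h0] at hpos
  have hS : 1 ≤ (S : ℝ) := by
    exact_mod_cast Nat.pos_of_ne_zero fun h0 => by simp [h0] at hpos
  have hA : 1 ≤ (A : ℝ) := by
    exact_mod_cast Nat.pos_of_ne_zero fun h0 => by simp [h0] at hpos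
  have hB : 1 ≤ (B : ℝ) := by
    exact_mod_cast Nat.pos_of_ne_zero fun h0 => by simp [h0] at hpos
  have hKr : 1 ≤ (K : ℝ) := by exact_mod_cast hK
  have hZ0 : 0 < Z := by linarith
  set m := min ε 1 with hm
  have hm0 : 0 < m := lt_min hε one_pos
  have hm1 : m ≤ 1 := min_le_right _ _
  have hmε : Real.log m ≤ Real.log ε := Real.log_le_log hm0 (min_le_left _ _)
  have hlm : Real.log m ≤ 0 := Real.log_nonpos hm0.le hm1
  have hlp : Real.log p ≤ 0 := Real.log_nonpos hp.le hp1.le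
  set q := Real.log (4 * M ^ 2) with hq
  have hq0 : 0 ≤ q := Real.log_nonneg (by nlinarith)
  have hι : Real.log (Z / (p * m)) = Real.log Z - Real.log p - Real.log m := by
    rw [Real.log_div hZ0.ne' (by positivity), Real.log_mul hp.ne' hm0.ne']; ring
  set i := Real.log (Z / (p * m)) with hi
  have hlZ : 1 / 2 ≤ Real.log Z := by
    have h1 := Real.log_le_log (by norm_num) hZ2
    have h2 := Real.log_two_gt_d9
    linarith
  have hi2 : 1 / 2 ≤ i := by linarith
  set X : ℝ := (H : ℝ) ^ 4 * (S : ℝ) ^ 2 * A * B with hX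
  have hX0 : 0 < X := by positivity
  have hXZ : Real.log X ≤ 4 * Real.log Z := by
    rw [show (4 : ℝ) * Real.log Z = Real.log (Z ^ 4) by rw [Real.log_pow]; norm_num]
    refine Real.log_le_log hX0 ?_
    rw [hX, hZdef, mul_pow, mul_pow, mul_pow]
    gcongr ?_ * ?_ * ?_ * ?_
    · exact pow_le_pow_right₀ hS (by norm_num)
    · exact le_self_pow₀ hA (by norm_num)
    · exact le_self_pow₀ hB (by norm_num)
  set b := M ^ 2 * X / ε ^ 2 with hb
  have hb0 : 0 < b := by positivity
  have hK1 : 4 * (4 + 2 * q) * (b * i) ≤ K := by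
    refine le_of_eq_of_le ?_ h
    rw [hb]; ring
  have hlog4b : Real.log (4 * b) = q + Real.log X - 2 * Real.log ε := by
    rw [show 4 * b = 4 * M ^ 2 * X / ε ^ 2 by rw [hb]; ring,
      Real.log_div (by positivity) (by positivity), Real.log_mul (by positivity) hX0.ne',
      Real.log_pow, ← hq]
    norm_num
  -- `log x ≤ x - 1` at `x = K / (4b)`; after multiplication by `b` only `K / 4` is spent on `log
  -- K`.
  have hlogK : Real.log K ≤ K / (4 * b) + Real.log (4 * b) := by
    have h1 := Real.log_le_sub_one_of_pos (show 0 < (K : ℝ) / (4 * b) by positivity)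
    rw [Real.log_div (by positivity) (by positivity)] at h1
    linarith
  have hL : Real.log ((S : ℝ) * A * B * (K * H) / p) =
      Real.log Z - Real.log p + Real.log K := by
    rw [show (S : ℝ) * A * B * (K * H) = Z * K by rw [hZdef]; ring,
      Real.log_div (by positivity) hp.ne', Real.log_mul hZ0.ne' (by positivity)]
    ring
  have h3 : Real.log ((S : ℝ) * A * B * (K * H) / p) ≤ K / (4 * b) + (5 + 2 * q) * i := by
    rw [hL]
    linarith [mul_le_mul_of_nonneg_left hi2 hq0]
  have h4 : b * Real.log ((S : ℝ) * A * B * (K * H) / p) ≤ K := by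
    have h5 := mul_le_mul_of_nonneg_left h3 hb0.le
    have h6 : b * (K / (4 * b) + (5 + 2 * q) * i) = K / 4 + (5 + 2 * q) * (b * i) := by
      field_simp
    have h7 : 0 ≤ b * i := by positivity
    linarith [mul_nonneg hq0 h7]
  calc M ^ 2 * (X * Real.log ((S : ℝ) * A * B * (K * H) / p))
      = ε ^ 2 * (b * Real.log ((S : ℝ) * A * B * (K * H) / p)) := by
        rw [hb]; field_simp
    _ ≤ ε ^ 2 * K := by gcongr

/-! ### Sampling from the deployed policies. -/

section Sampling

theorem expect_map_of_fintype {α β : Type*} [Fintype α] (q : PMF α) (g : α → β) (f : β → ℝ) :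
    expect (q.map g) f = expect q fun x => f (g x) := by
  rw [← PMF.bind_pure_comp, expect_bind _ _ fun x => by
    rw [Function.comp, PMF.support_pure]; exact Set.finite_singleton _, expect_eq_sum]
  simp [expect_pure]

/-- Only the marginals of the sampling law matter. -/
theorem IsUniformSampling.expect_le {K : ℕ} {q : PMF (Fin K × Fin K)} (hq : IsUniformSampling q)
    {f g : ℕ → ℝ} {ε : ℝ} (h : ∑ k ∈ Finset.range K, (f k - g k) ≤ K * ε) :
    expect q (fun ij => f ij.2 - g ij.1) ≤ ε := by
  have hK : 0 < K := by
    rcases Nat.eq_zero_or_pos K with rfl | hK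
    · obtain ⟨x, -⟩ := q.support_nonempty
      exact x.1.elim0
    · exact hK
  have hKr : (0 : ℝ) < K := by exact_mod_cast hK
  have h1 : expect q (fun ij => f ij.2 - g ij.1) =
      expect (q.map Prod.snd) (fun j => f j) - expect (q.map Prod.fst) (fun i => g i) := by
    rw [expect_map_of_fintype, expect_map_of_fintype]
    simp only [expect_eq_sum, mul_sub, Finset.sum_sub_distrib]
  have h2 : ∀ e : ℕ → ℝ, ∑ k : Fin K, ((K : ℝ≥0∞)⁻¹).toReal * e k =
      (K : ℝ)⁻¹ * ∑ k ∈ Finset.range K, e k := by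
    intro e
    rw [← Finset.mul_sum, Finset.sum_range]
    simp
  rw [h1, expect_eq_sum, expect_eq_sum]
  simp only [hq.1, hq.2, h2]
  rw [← mul_sub, ← Finset.sum_sub_distrib, inv_mul_le_iff₀ hKr]
  exact h

end Sampling

/-! ### Degenerate cases, regret bound and failure probability. -/

namespace MarkovGame

variable {H : ℕ} (G : MarkovGame.{u, v, w} H)

theorem gap_le_horizon (μ : G.MaxPolicy) (ν : G.MinPolicy) (s : G.State 0) :
    G.valueMaxBest ν s - G.valueMinBest μ s ≤ H := by
  have : Nonempty G.MaxPolicy := ⟨μ⟩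
  have : Nonempty G.MinPolicy := ⟨ν⟩
  have h1 : G.valueMaxBest ν s ≤ H := ciSup_le fun μ => by simpa using (G.value_mem μ ν 0 s).2
  have h2 : 0 ≤ G.valueMinBest μ s := le_ciInf fun ν => (G.value_mem μ ν 0 s).1
  linarith

theorem subsingleton_pmf {α : Type*} [Fintype α] (h : Fintype.card α ≤ 1) :
    Subsingleton (PMF α) := by
  refine ⟨fun q q' => PMF.ext fun x => ?_⟩
  have := Fintype.card_le_one_iff_subsingleton.1 h
  have h1 : ∀ q : PMF α, q x = 1 := by
    intro q
    rw [← q.tsum_coe, tsum_eq_single x fun y hy => absurd (Subsingleton.elim y x) hy]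
  rw [h1, h1]

theorem gap_eq_zero (hA : ∀ h, Fintype.card (G.ActMax h) ≤ 1)
    (hB : ∀ h, Fintype.card (G.ActMin h) ≤ 1) (μ : G.MaxPolicy) (ν : G.MinPolicy)
    (s : G.State 0) : G.valueMaxBest ν s - G.valueMinBest μ s = 0 := by
  have := fun h => subsingleton_pmf (hA h)
  have := fun h => subsingleton_pmf (hB h)
  have : Unique G.MaxPolicy := ⟨⟨μ⟩, fun _ => Subsingleton.elim _ _⟩
  have : Unique G.MinPolicy := ⟨⟨ν⟩, fun _ => Subsingleton.elim _ _⟩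
  rw [valueMaxBest, valueMinBest, ciSup_unique, ciInf_unique, sub_eq_zero]
  congr 1 <;> exact Subsingleton.elim _ _

theorem toOuterMeasure_univ {α : Type*} (q : PMF α) : q.toOuterMeasure Set.univ = 1 :=
  (PMF.toOuterMeasure_apply_eq_one_iff q Set.univ).2 (Set.subset_univ _)

/-- The regret bound of VI-ULCB on the event that the confidence sets hold and that the realized
widths control their conditional expectations. -/
theorem sum_gap_le {S A B : ℕ} (hH : 1 ≤ H) (hS : ∀ h, Fintype.card (G.State h) ≤ S)
    (hA : ∀ h, Fintype.card (G.ActMax h) ≤ A) (hB : ∀ h, Fintype.card (G.ActMin h) ≤ B)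
    {nash : G.MatrixSolver} (hnash : nash.IsNash) {bonus : ℕ → ℝ} (hb0 : ∀ n, 0 ≤ bonus n)
    {s₁ : G.State 0} {K : ℕ} {y y' w : ℝ} (hw : 0 ≤ w)
    (hb : ∀ n : ℕ, n ≠ 0 → H * Real.sqrt (2 * y * n) ≤ n * bonus n)
    (hbw : ∀ n : ℕ, bonus (n + 1) ≤ w / Real.sqrt (n + 1))
    {hist : List (List G.Obs)} (hh : hist ∈ (G.ulcbRun nash bonus s₁ K).support)
    (hc : ∀ k : Fin K, G.Concentrated y (hist.take k).flatten)
    (hx : ∑ k ∈ Finset.range K, G.nextExpect nash bonus s₁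
        (fun D τ => ((H : ℝ) ^ 2)⁻¹ * (τ.map (obsWidth bonus D)).sum) (hist.take k).flatten ≤
      2 * ∑ k ∈ Finset.range K, ((H : ℝ) ^ 2)⁻¹ *
        ((hist.getD k []).map (obsWidth bonus (hist.take k).flatten)).sum + 2 * y') :
    ∑ k ∈ Finset.range K, (G.valueMaxBest (G.deployedMin nash bonus hist k) s₁ -
      G.valueMinBest (G.deployedMax nash bonus hist k) s₁) ≤
      2 * ((H * (S * (A * B)) : ℝ) * H +
        8 * w * Real.sqrt (H * (S * (A * B)) * (K * H))) + 2 * H ^ 2 * y' := by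
  obtain ⟨hlen, hsup⟩ := G.ulcbRun_support hist hh
  have hHpos : (0 : ℝ) < (H : ℝ) ^ 2 := by positivity
  have h1 : ∑ k ∈ Finset.range K, (G.valueMaxBest (G.deployedMin nash bonus hist k) s₁ -
      G.valueMinBest (G.deployedMax nash bonus hist k) s₁) ≤
      (H : ℝ) ^ 2 * ∑ k ∈ Finset.range K, G.nextExpect nash bonus s₁
        (fun D τ => ((H : ℝ) ^ 2)⁻¹ * (τ.map (obsWidth bonus D)).sum) (hist.take k).flatten := by
    rw [Finset.mul_sum]
    refine Finset.sum_le_sum fun k hk => ?_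
    have hval : G.RewardsValid (hist.take k).flatten := by
      intro o ho
      obtain ⟨τ, hτ, ho⟩ := List.mem_flatten.1 ho
      exact (hsup τ (List.mem_of_mem_take hτ)).1 o ho
    refine (duality_gap_le (hc ⟨k, Finset.mem_range.1 hk⟩) hb hval hb0 hnash s₁).trans ?_
    rw [nextExpect, expect_const_mul, ← mul_assoc, mul_inv_cancel₀ hHpos.ne', one_mul, expectSum]
  have h2 := sum_cumWidth_le (G := G) (H := H) hw hbw hist.flatten
    (m := (H * (S * (A * B)) : ℝ)) (by exact_mod_cast G.card_idx_le hS hA hB)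
  have h3 : (hist.flatten.length : ℝ) = K * H := by
    rw [List.length_flatten, List.sum_eq_card_nsmul _ H, List.length_map, hlen]
    · simp
    · intro m hm
      obtain ⟨τ, hτ, rfl⟩ := List.mem_map.1 hm
      exact (hsup τ hτ).2.2
  rw [h3, ← sum_obsWidth_run hlen fun τ hτ => (hsup τ hτ).2.1] at h2
  have h4 := mul_le_mul_of_nonneg_left hx hHpos.le
  rw [← Finset.mul_sum, mul_add, mul_left_comm _ 2, ← mul_assoc _ _ (Finset.sum _ _),
    mul_inv_cancel₀ hHpos.ne', one_mul] at h4
  linarith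

/-- The union bound for the confidence sets fails with probability at most `p / 2`. -/
theorem union_bound_le {H S A B K : ℕ} (hH : 1 ≤ H) (hS : 1 ≤ S) (hA : 1 ≤ A) (hB : 1 ≤ B)
    (hK : 1 ≤ K) (hZ : 2 ≤ H * S * A * B) {p : ℝ} (hp : 0 < p) (hp1 : p < 1) :
    (K * (H * (S * (A * (B * ((2 ^ S : ℕ) * ((K * H + 1 : ℕ) *
      Real.exp (-(5 * S * Real.log ((S : ℝ) * A * B * (K * H) / p))))))))) : ℝ) ≤ p / 2 := by
  set Y : ℝ := (S : ℝ) * A * B * (K * H) / p with hY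
  have hSr : (1 : ℝ) ≤ S := by exact_mod_cast hS
  have hAr : (1 : ℝ) ≤ A := by exact_mod_cast hA
  have hBr : (1 : ℝ) ≤ B := by exact_mod_cast hB
  have hKr : (1 : ℝ) ≤ K := by exact_mod_cast hK
  have hHr : (1 : ℝ) ≤ H := by exact_mod_cast hH
  have hZr : (2 : ℝ) ≤ H * S * A * B := by exact_mod_cast hZ
  have hpY : p * Y = (S : ℝ) * A * B * (K * H) := by rw [hY]; field_simp
  have hY0 : 0 < Y := by positivity
  have hle : (S : ℝ) * A * B * (K * H) ≤ Y := by rw [← hpY]; exact mul_le_of_le_one_left hY0.le hp1.le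
  have hY2 : 2 ≤ Y := by
    refine le_trans ?_ hle
    calc (2 : ℝ) ≤ H * S * A * B * 1 := by linarith
      _ ≤ H * S * A * B * K := by gcongr
      _ = _ := by ring
  have hKH : ((K * H + 1 : ℕ) : ℝ) ≤ 2 * Y := by
    have h1 : (1 : ℝ) * 1 ≤ K * H := by gcongr
    have h2 : (1 : ℝ) * 1 * 1 * (K * H) ≤ S * A * B * (K * H) := by gcongr
    push_cast
    linarith
  have hexp : Real.exp (-(5 * S * Real.log Y)) = (Y ^ (5 * S))⁻¹ := by
    rw [Real.exp_neg, show 5 * (S : ℝ) * Real.log Y = ((5 * S : ℕ) : ℝ) * Real.log Y by push_cast; ring,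
      Real.exp_nat_mul, Real.exp_log hY0]
  -- `Y ≥ 2` pays for the `2 ^ S` subsets with `Y ^ S`; four more powers cover the other indices and
  -- the constants, and `S + 4 ≤ 5 * S`.
  have hpow : 2 ^ S * Y ^ 2 * 4 ≤ Y ^ (5 * S) := by
    calc 2 ^ S * Y ^ 2 * 4 ≤ Y ^ S * Y ^ 2 * Y ^ 2 := by
          gcongr
          exact (by norm_num : (4 : ℝ) = 2 ^ 2).trans_le (by gcongr)
      _ = Y ^ (S + 4) := by ring
      _ ≤ Y ^ (5 * S) := pow_le_pow_right₀ (by linarith) (by omega)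
  rw [hexp]
  calc (K * (H * (S * (A * (B * ((2 ^ S : ℕ) * ((K * H + 1 : ℕ) * (Y ^ (5 * S))⁻¹)))))) : ℝ)
      = p * Y * 2 ^ S * ((K * H + 1 : ℕ) : ℝ) * (Y ^ (5 * S))⁻¹ := by
        rw [hpY]; push_cast; ring
    _ ≤ p * Y * 2 ^ S * (2 * Y) * (2 ^ S * Y ^ 2 * 4)⁻¹ := by gcongr
    _ = p / 2 := by field_simp; norm_num

end MarkovGame

/-! ### Assembly of the constants and the events. -/

open MarkovGame in
theorem corollary2 :
    ∃ c₀ : ℝ, 0 < c₀ ∧ ∀ c : ℝ, c₀ ≤ c → ∃ C : ℝ, 0 < C ∧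
      ∀ (H S A B : ℕ) (G : MarkovGame.{u, v, w} H), 1 ≤ H →
        (∀ h, Fintype.card (G.State h) ≤ S) →
        (∀ h, Fintype.card (G.ActMax h) ≤ A) →
        (∀ h, Fintype.card (G.ActMin h) ≤ B) →
      ∀ (nash : G.MatrixSolver), nash.IsNash →
      ∀ (s₁ : G.State 0) (p ε : ℝ), 0 < p → p < 1 → 0 < ε →
      ∀ (K : ℕ), 1 ≤ K →
        C * ((H : ℝ) ^ 4 * (S : ℝ) ^ 2 * A * B *
          Real.log ((H : ℝ) * S * A * B / (p * min ε 1)) / ε ^ 2) ≤ K →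
        ENNReal.ofReal (1 - p) ≤
          (G.ulcbRun nash (ulcbBonus c H S A B K p) s₁ K).toOuterMeasure
            {hist | ∀ q : PMF (Fin K × Fin K), IsUniformSampling q →
              expect q (fun ij =>
                G.valueMaxBest (G.deployedMin nash (ulcbBonus c H S A B K p) hist ij.2) s₁ -
                G.valueMinBest (G.deployedMax nash (ulcbBonus c H S A B K p) hist ij.1) s₁)
                ≤ ε} := by
  refine ⟨4, by norm_num, fun c hc => ?_⟩
  -- The regret is at most `εK / M` times `16c` from the widths after the first visits, `4` from the
  -- first visits and `2` from the Chernoff term.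
  set M : ℝ := 16 * c + 6 with hM
  have hM1 : 1 ≤ M := by linarith
  have hq0 : 0 ≤ Real.log (4 * M ^ 2) := Real.log_nonneg (by nlinarith)
  refine ⟨4 * M ^ 2 * (4 + 2 * Real.log (4 * M ^ 2)), by positivity, ?_⟩
  intro H S A B G hH hS hA hB nash hnash s₁ p ε hp hp1 hε K hK hKC
  set bonus := ulcbBonus c H S A B K p with hbonus
  set run := G.ulcbRun nash bonus s₁ K with hrun
  have of_gap : ∀ hist : List (List G.Obs),
      ∑ k ∈ Finset.range K, (G.valueMaxBest (G.deployedMin nash bonus hist k) s₁ -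
        G.valueMinBest (G.deployedMax nash bonus hist k) s₁) ≤ K * ε →
      ∀ q : PMF (Fin K × Fin K), IsUniformSampling q →
        expect q (fun ij => G.valueMaxBest (G.deployedMin nash bonus hist ij.2) s₁ -
          G.valueMinBest (G.deployedMax nash bonus hist ij.1) s₁) ≤ ε := by
    intro hist hs q hq
    exact hq.expect_le (f := fun k => G.valueMaxBest (G.deployedMin nash bonus hist k) s₁)
      (g := fun k => G.valueMinBest (G.deployedMax nash bonus hist k) s₁) hs
  have of_forall : (∀ μ ν, G.valueMaxBest ν s₁ - G.valueMinBest μ s₁ ≤ ε) →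
      ENNReal.ofReal (1 - p) ≤ run.toOuterMeasure
        {hist | ∀ q : PMF (Fin K × Fin K), IsUniformSampling q →
          expect q (fun ij => G.valueMaxBest (G.deployedMin nash bonus hist ij.2) s₁ -
            G.valueMinBest (G.deployedMax nash bonus hist ij.1) s₁) ≤ ε} := by
    intro hg
    rw [Set.eq_univ_of_forall (s := {hist | ∀ q : PMF (Fin K × Fin K), IsUniformSampling q →
          expect q (fun ij => G.valueMaxBest (G.deployedMin nash bonus hist ij.2) s₁ -
            G.valueMinBest (G.deployedMax nash bonus hist ij.1) s₁) ≤ ε}) fun hist =>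
        of_gap hist ?_, toOuterMeasure_univ]
    · exact ENNReal.ofReal_le_one.2 (by linarith)
    · exact (Finset.sum_le_card_nsmul _ _ ε fun k _ => hg _ _).trans (by simp)
  have hS1 : 1 ≤ S := (Fintype.card_pos_iff.2 ⟨s₁⟩).trans_le (hS 0)
  have hA1 : 1 ≤ A := Fintype.card_pos.trans_le (hA ⟨0, hH⟩)
  have hB1 : 1 ≤ B := Fintype.card_pos.trans_le (hB ⟨0, hH⟩)
  rcases le_or_gt (H : ℝ) ε with hHε | hHε
  · exact of_forall fun μ ν => (G.gap_le_horizon μ ν s₁).trans hHε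
  -- If `HSAB = 1` the logarithms have no positive lower bound, but each player then has only one
  -- policy and the gap vanishes.
  rcases lt_or_ge (H * S * A * B) 2 with hZ | hZ
  · have h1 : H * S * A * B = 1 := by
      have : 0 < H * S * A * B := by positivity
      omega
    rw [mul_eq_one, mul_eq_one] at h1
    obtain ⟨⟨-, rfl⟩, rfl⟩ := h1
    exact of_forall fun μ ν => (G.gap_eq_zero hA hB μ ν s₁).trans_le hε.le
  have hfinal := mul_log_le_of_le hM1 hK hZ hp hp1 hε hKC
  have hHr : (1 : ℝ) ≤ H := by exact_mod_cast hH
  have hSr : (1 : ℝ) ≤ S := by exact_mod_cast hS1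
  have hAr : (1 : ℝ) ≤ A := by exact_mod_cast hA1
  have hBr : (1 : ℝ) ≤ B := by exact_mod_cast hB1
  have hKr : (1 : ℝ) ≤ K := by exact_mod_cast hK
  have hZK : (2 : ℝ) ≤ S * A * B * (K * H) := by
    have h1 : (2 : ℝ) ≤ H * S * A * B := by exact_mod_cast hZ
    calc (2 : ℝ) ≤ H * S * A * B * 1 := by linarith
      _ ≤ H * S * A * B * K := by gcongr
      _ = _ := by ring
  set L := Real.log ((S : ℝ) * A * B * (K * H) / p) with hL
  have hLp : Real.log (2 / p) ≤ L := Real.log_le_log (by positivity) (by gcongr)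
  have hL2 : 1 / 2 ≤ L := by
    refine le_trans ?_ hLp
    have h2 := Real.log_two_gt_d9
    have h1 := Real.log_le_log (show (0 : ℝ) < 2 by norm_num)
      (show 2 ≤ 2 / p by rw [le_div_iff₀ hp]; linarith)
    linarith
  have hc0 : 0 < c := by linarith
  have hbdef : ∀ n : ℕ, bonus n = c * Real.sqrt ((H : ℝ) ^ 2 * S * L / n) := fun n => rfl
  have hb0 : ∀ n, 0 ≤ bonus n := fun n => by rw [hbdef]; positivity
  -- The choice `c₀ = 4` enters here: `2 * 5 ≤ 4 ^ 2`.
  have hb : ∀ n : ℕ, n ≠ 0 → H * Real.sqrt (2 * (5 * S * L) * n) ≤ n * bonus n := by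
    intro n hn
    have hn0 : (0 : ℝ) < n := by positivity
    rw [hbdef]
    calc H * Real.sqrt (2 * (5 * S * L) * n) = Real.sqrt (H ^ 2 * (2 * (5 * S * L) * n)) := by
          rw [Real.sqrt_mul (sq_nonneg (H : ℝ)), Real.sqrt_sq (by positivity)]
      _ ≤ Real.sqrt ((4 * n) ^ 2 * (H ^ 2 * S * L / n)) := by
          refine Real.sqrt_le_sqrt ?_
          have : (4 * (n : ℝ)) ^ 2 * (H ^ 2 * S * L / n) = 16 * (H ^ 2 * S * L * n) := by
            field_simp; norm_num
          rw [this]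
          have : 0 ≤ (H : ℝ) ^ 2 * S * L * n := by positivity
          linarith
      _ = 4 * n * Real.sqrt (H ^ 2 * S * L / n) := by
          rw [Real.sqrt_mul (by positivity), Real.sqrt_sq (by positivity)]
      _ ≤ c * n * Real.sqrt (H ^ 2 * S * L / n) := by gcongr
      _ = _ := by ring
  set W := c * Real.sqrt ((H : ℝ) ^ 2 * S * L) with hW
  have hW0 : 0 ≤ W := by positivity
  have hbw : ∀ n : ℕ, bonus (n + 1) ≤ W / Real.sqrt (n + 1) := by
    intro n
    rw [hbdef, hW, mul_div_assoc c, Real.sqrt_div (by positivity)]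
    push_cast
    exact le_rfl
  set X : List G.Obs → List G.Obs → ℝ :=
    fun D τ => ((H : ℝ) ^ 2)⁻¹ * (τ.map (obsWidth bonus D)).sum with hX
  have hXmem : ∀ D τ, τ.length = H → X D τ ∈ Set.Icc (0 : ℝ) 1 := by
    intro D τ hτ
    have hm : ∀ x ∈ τ.map (obsWidth bonus D), x ∈ Set.Icc (0 : ℝ) H := by
      intro x hx
      obtain ⟨o, -, rfl⟩ := List.mem_map.1 hx
      exact width_mem hb0 _
    refine ⟨mul_nonneg (by positivity) (List.sum_nonneg fun x hx => (hm x hx).1), ?_⟩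
    have h1 := List.sum_le_card_nsmul (τ.map (obsWidth bonus D)) (H : ℝ) fun x hx => (hm x hx).2
    rw [List.length_map, hτ, nsmul_eq_mul, ← sq] at h1
    exact (inv_mul_le_iff₀ (by positivity)).2 (by simpa using h1)
  have hgood : ∀ hist ∈ run.support,
      (∀ k : Fin K, G.Concentrated (5 * S * L) (hist.take k).flatten) →
      ∑ k ∈ Finset.range K, G.nextExpect nash bonus s₁ X (hist.take k).flatten ≤
        2 * ∑ k ∈ Finset.range K, X (hist.take k).flatten (hist.getD k []) +
          2 * Real.log (2 / p) →
      ∑ k ∈ Finset.range K, (G.valueMaxBest (G.deployedMin nash bonus hist k) s₁ -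
        G.valueMinBest (G.deployedMax nash bonus hist k) s₁) ≤ K * ε := by
    intro hist hh h1 h2
    refine (G.sum_gap_le hH hS hA hB hnash hb0 hW0 hb hbw hh h1 h2).trans ?_
    have hM0 : 0 < M := by linarith
    have e1 : W * Real.sqrt (H * (S * (A * B)) * (K * H)) ≤ c * (ε * K / M) := by
      rw [hW, mul_assoc, ← Real.sqrt_mul (by positivity)]
      refine mul_le_mul_of_nonneg_left (Real.sqrt_le_iff.2 ⟨by positivity, ?_⟩) hc0.le
      rw [div_pow, le_div_iff₀ (by positivity)]
      linarith [mul_le_mul_of_nonneg_right hfinal (show (0 : ℝ) ≤ K by positivity)]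
    -- With `ε < H`, the bound by `ε² K` becomes linear in `ε`, as the terms without a square root
    -- require; the extra `H` is absorbed by `H⁴`.
    have e0 : M ^ 2 * ((H : ℝ) ^ 4 * (S : ℝ) ^ 2 * A * B * L) ≤ H * (ε * K) := by
      refine hfinal.trans ?_
      rw [sq, mul_assoc]
      gcongr
    have e2 : M ^ 2 * ((H * (S * (A * B)) : ℝ) * H) ≤ 2 * (ε * K) := by
      refine le_of_mul_le_mul_left ?_ (show (0 : ℝ) < H by linarith)
      calc (H : ℝ) * (M ^ 2 * ((H * (S * (A * B)) : ℝ) * H))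
          = 2 * (M ^ 2 * (H ^ 3 * S ^ 1 * A * B * (1 / 2))) := by ring
        _ ≤ 2 * (M ^ 2 * (H ^ 4 * S ^ 2 * A * B * L)) := by
            gcongr <;> first | assumption | norm_num
        _ ≤ 2 * (H * (ε * K)) := by linarith
        _ = _ := by ring
    have e3 : M ^ 2 * ((H : ℝ) ^ 2 * Real.log (2 / p)) ≤ ε * K := by
      refine le_of_mul_le_mul_left ?_ (show (0 : ℝ) < H by linarith)
      calc (H : ℝ) * (M ^ 2 * ((H : ℝ) ^ 2 * Real.log (2 / p)))
          = M ^ 2 * (H ^ 3 * 1 ^ 2 * 1 * 1 * Real.log (2 / p)) := by ring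
        _ ≤ M ^ 2 * (H ^ 4 * S ^ 2 * A * B * L) := by
            have : 0 ≤ Real.log (2 / p) := Real.log_nonneg (by rw [le_div_iff₀ hp]; linarith)
            gcongr <;> first | assumption | norm_num
        _ ≤ H * (ε * K) := e0
    have hεK : 0 ≤ ε * K := by positivity
    have down : ∀ x r : ℝ, 0 ≤ r → M ^ 2 * x ≤ r → M * x ≤ r := by
      intro x r hr hxr
      rcases le_total x 0 with hx | hx
      · exact (mul_nonpos_of_nonneg_of_nonpos hM0.le hx).trans hr
      · exact le_trans (mul_le_mul_of_nonneg_right (le_self_pow₀ hM1 two_ne_zero) hx) hxr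
    have e2' := down _ _ (by positivity) e2
    have e3' := down _ _ hεK e3
    have e1' : M * (W * Real.sqrt (H * (S * (A * B)) * (K * H))) ≤ c * (ε * K) := by
      refine (mul_le_mul_of_nonneg_left e1 hM0.le).trans_eq ?_
      field_simp
    refine le_of_mul_le_mul_left ?_ hM0
    have : M * (K * ε) = 16 * (c * (ε * K)) + 6 * (ε * K) := by rw [hM]; ring
    rw [this]
    linarith
  set good := {hist | ∀ q : PMF (Fin K × Fin K), IsUniformSampling q →
      expect q (fun ij => G.valueMaxBest (G.deployedMin nash bonus hist ij.2) s₁ -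
        G.valueMinBest (G.deployedMax nash bonus hist ij.1) s₁) ≤ ε} with hgooddef
  have hcover : (Set.univ : Set (List (List G.Obs))) ⊆ good ∪ ({hist | hist ∉ run.support} ∪
      ({hist | ∃ k : Fin K, ¬ G.Concentrated (5 * S * L) (hist.take k).flatten} ∪
      {hist | 2 * ∑ k ∈ Finset.range K, X (hist.take k).flatten (hist.getD k []) +
          2 * Real.log (2 / p) <
        ∑ k ∈ Finset.range K, G.nextExpect nash bonus s₁ X (hist.take k).flatten})) := by
    intro hist _
    by_contra hn
    simp only [Set.mem_union, not_or, Set.mem_ofPred_eq, not_not, not_exists, not_lt] at hn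
    exact hn.1 (of_gap hist (hgood hist hn.2.1 hn.2.2.1 hn.2.2.2))
  have hsupp : run.toOuterMeasure {hist | hist ∉ run.support} = 0 := by
    rw [PMF.toOuterMeasure_apply_eq_zero_iff, Set.disjoint_left]
    exact fun x hx hx' => hx' hx
  have hconc := (G.toOuterMeasure_not_concentrated_le nash bonus s₁ K
    (y := 5 * S * L) (by positivity) hS hA hB).trans
      (ENNReal.ofReal_le_ofReal (union_bound_le hH hS1 hA1 hB1 hK hZ hp hp1))
  have hcher := G.toOuterMeasure_chernoff_le nash bonus s₁ X hXmem K (Real.log (2 / p))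
  rw [Real.exp_neg, Real.exp_log (by positivity), inv_div] at hcher
  have htotal : 1 ≤ run.toOuterMeasure good + ENNReal.ofReal p := by
    rw [← toOuterMeasure_univ run]
    refine (MeasureTheory.measure_mono hcover).trans ((MeasureTheory.measure_union_le _ _).trans ?_)
    gcongr
    refine (MeasureTheory.measure_union_le _ _).trans ?_
    rw [hsupp, zero_add]
    refine (MeasureTheory.measure_union_le _ _).trans ((add_le_add hconc hcher).trans_eq ?_)
    rw [← ENNReal.ofReal_add (by positivity) (by positivity), add_halves]
  rw [ENNReal.ofReal_sub _ hp.le, ENNReal.ofReal_one]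
  exact tsub_le_iff_right.2 htotal
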